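/- **Conventions.** Let $Y$ be a graph in the sense of Serre: a set $V(Y)$ of vertices, a set $E(Y)$ of edges, each edge $y$ having a start $y\alpha$ and an end $y\omega$, and a fixed-point-free involution $y\mapsto\overline y$ of $E(Y)$ with $\overline y\,\omega=y\alpha$. A *graph of groups* $(G,Y)$ consists of groups $G_v$ ($v\in V(Y)$), groups $G_y=G_{\overline y}$ ($y\in E(Y)$) and injective homomorphisms $\alpha_y:G_y\to G_{y\alpha}$, $\omega_y:G_y\to G_{y\omega}$ with $\alpha_y=\omega_{\overline y}$. Let $F(G,Y)$ be the group generated by the vertex groups and the edges, subject to the relations of the vertex groups and to $y\overline y=1$ and $y\,(g\omega_y)\,\overline y=g\alpha_y$ for $y\in E(Y)$, $g\in G_y$. For $v_0\in V(Y)$ the *fundamental group* $\pi_1(G,Y,v_0)$ is the subgroup of $F(G,Y)$ of all elements $g_0y_1g_1\cdots y_ng_n$ such that $y_1\cdots y_n$ is an edge path from $v_0$ to $v_0$, $g_0\in G_{v_0}$ and $g_i\in G_{y_i\omega}$; a word over the edges and over generators of the vertex groups that spells an element in this form is *of cycle type at $v_0$*. Let $M$ be a monoid with a finite generating family $X$.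 The *rational subset problem* for $M$ is the following decision problem: given a finite automaton with edges labelled by words over $X$, and a word over $X$, decide whether the element of $M$ represented by the word lies in the subset of $M$ recognised by the automaton, i.e. is the label of a path from the initial vertex to a terminal vertex. (Its decidability does not depend on $X$.) **Theorem.** Let $(G,Y)$ be a graph of groups with $Y$ finite, connected and non-empty, with finitely generated vertex groups and with finite edge groups, and let $v_0\in V(Y)$. Then $\pi_1(G,Y,v_0)$ has decidable rational subset problem if and only if every vertex group $G_v$ has decidable rational subset problem. Moreover, the equivalence is effective, uniformly in $(G,Y)$, in the following sense. Fix finite monoid generating families $X_v$ of the groups $G_v$ and $X$ of $\pi_1(G,Y,v_0)$. Let a *description* of these data be given by the finite graph $Y$ with its base vertex $v_0$, the sizes of the sets $X_v$, for every edge $y$ a list of pairs of words over $X_{y\alpha}$ and $X_{y\omega}$ representing exactly the pairs $(g\alpha_y,g\omega_y)$, $g\in G_y$, and for every $x\in X$ a word of cycle type at $v_0$ over $E(Y)\cup\bigcup_vX_v$ representing $x$. * There is an algorithm which, given a description and, for every $v$, an algorithm that solves the rational subset problem for $G_v$ over $X_v$, outputs an algorithm that solves the rational subset problem for $\pi_1(G,Y,v_0)$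 over $X$. * There is an algorithm which, given a description, an algorithm that solves the rational subset problem for $\pi_1(G,Y,v_0)$ over $X$, a vertex $v$, and words over $X$ that represent the images of the generators in $X_{v'}$, for all vertices $v'$, under embeddings $g\mapsto p_{v'}\,g\,p_{v'}^{-1}$ of $G_{v'}$ into $\pi_1(G,Y,v_0)$ (where $p_{v'}\in F(G,Y)$ is the value of some path from $v_0$ to $v'$, with elements of the vertex groups inserted along the path), outputs an algorithm that solves the rational subset problem for $G_v$ over $X_v$. -/

import Mathlib

/-! ## Finite automata over a finitely generated monoid and the rational subset problem -/

namespace RatSub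

/-- The element of `M` represented by a word over the finite family `gen`. -/
def wordVal {M : Type*} [Monoid M] {n : ℕ} (gen : Fin n → M) (w : List (Fin n)) : M :=
  (w.map gen).prod

/-- `gen` generates `M` as a monoid. -/
def Generates {M : Type*} [Monoid M] {n : ℕ} (gen : Fin n → M) : Prop :=
  Submonoid.closure (Set.range gen) = ⊤

/-- (Encoded) finite automata whose edges are labelled by words over an `n`-letter alphabet:
the initial vertex, the list of terminal vertices, and the list of edges
`(start, label, end)`. Vertices are named by natural numbers. -/
abbrev Automaton (n : ℕ) : Type := ℕ × List ℕ × List (ℕ × List (Fin n) × ℕ)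

/-- `Run gen E p q x`: using the edges in `E` there is a path from `p` to `q` whose label,
multiplied out in `M`, is `x`. -/
inductive Run {M : Type*} [Monoid M] {n : ℕ} (gen : Fin n → M)
    (E : List (ℕ × List (Fin n) × ℕ)) : ℕ → ℕ → M → Prop
  | nil (p : ℕ) : Run gen E p p 1
  | cons {p q s : ℕ} {w : List (Fin n)} {x : M} (h : (p, w, q) ∈ E) (hx : Run gen E q s x) :
      Run gen E p s (wordVal gen w * x)

/-- The rational subset of `M` recognised by an automaton. -/
def recognised {M : Type*} [Monoid M] {n : ℕ} (gen : Fin n → M) (A : Automaton n) : Set M :=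
  {x | ∃ t ∈ A.2.1, Run gen A.2.2 A.1 t x}

/-- The instances `(A, w)` of the rational subset problem with answer "yes": the element
represented by `w` lies in the subset recognised by `A`. -/
def RationalMembership {M : Type*} [Monoid M] {n : ℕ} (gen : Fin n → M)
    (I : Automaton n × List (Fin n)) : Prop :=
  wordVal gen I.2 ∈ recognised gen I.1

/-- The monoid `M` is finitely generated and its rational subset problem (over a finite
generating family) is decidable. -/
def DecidableRationalSubsetProblem (M : Type*) [Monoid M] : Prop :=
  ∃ (n : ℕ) (gen : Fin n → M), Generates gen ∧ ComputablePred (RationalMembership gen)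

/-- The program `c` decides the rational subset problem of `M` over `gen`: on every
instance it halts, with output `1` or `0` according to whether the answer is "yes" or "no". -/
def Decides {M : Type*} [Monoid M] {n : ℕ} (c : Nat.Partrec.Code) (gen : Fin n → M) : Prop :=
  ∀ I : Automaton n × List (Fin n),
    (RationalMembership gen I → c.eval (Encodable.encode I) = Part.some 1) ∧
    (¬ RationalMembership gen I → c.eval (Encodable.encode I) = Part.some 0)

end RatSub

/-! ## Graphs of groups -/

universe u v w x

/-- A graph of groups with vertex set `V`. The set of (oriented) edges is `ε × Bool`: the two
orientations `(e, true)`, `(e, false)` of an element `e` of `ε` are exchanged by the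
fixed-point-free involution `bar`. The edge group of `y = (e, b)` is `K e`, so it is
literally the same for `y` and `bar y`; `α y` is its embedding into the group at the start
of `y`. The end of `y` is the start of `bar y`, and the embedding `ω y` into the
group at the end of `y` is `α (bar y)`; both are defined below. -/
structure GraphOfGroups (V : Type u) (ε : Type v) where
  src : ε × Bool → V
  G : V → Type w
  [groupG : ∀ a, Group (G a)]
  K : ε → Type x
  [groupK : ∀ e, Group (K e)]
  α : ∀ y : ε × Bool, K y.1 →* G (src y)
  α_injective : ∀ y, Function.Injective (α y)

namespace GraphOfGroups

attribute [instance] GraphOfGroups.groupG GraphOfGroups.groupK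

variable {V : Type u} {ε : Type v}

/-- The orientation-reversing involution on edges. -/
def bar (y : ε × Bool) : ε × Bool := (y.1, !y.2)

theorem bar_bar (y : ε × Bool) : bar (bar y) = y := by
  simp [bar]

variable (𝒢 : GraphOfGroups.{u, v, w, x} V ε)

/-- The end of an edge. -/
def tgt (y : ε × Bool) : V := 𝒢.src (bar y)

/-- The embedding of the edge group into the group at the end of the edge. -/
def ω (y : ε × Bool) : 𝒢.K y.1 →* 𝒢.G (𝒢.tgt y) := 𝒢.α (bar y)

/-- The underlying graph is connected (any two vertices are joined by an edge path). -/
def Connected : Prop :=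
  ∀ a b : V, Relation.ReflTransGen (fun c d => ∃ y, 𝒢.src y = c ∧ 𝒢.tgt y = d) a b

/-- The free product of all vertex groups and the free group on the edges. -/
abbrev FreeProd : Type _ := Monoid.Coprod (Monoid.CoprodI 𝒢.G) (FreeGroup (ε × Bool))

/-- The relators `y ȳ` and `y (g ω_y) ȳ (g α_y)⁻¹`. -/
def relators : Set 𝒢.FreeProd :=
  {r | ∃ y : ε × Bool,
      r = Monoid.Coprod.inr (FreeGroup.of y) * Monoid.Coprod.inr (FreeGroup.of (bar y))} ∪
  {r | ∃ (y : ε × Bool) (g : 𝒢.K y.1),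
      r = Monoid.Coprod.inr (FreeGroup.of y) * Monoid.Coprod.inl (Monoid.CoprodI.of (𝒢.ω y g)) *
        Monoid.Coprod.inr (FreeGroup.of (bar y)) *
        (Monoid.Coprod.inl (Monoid.CoprodI.of (𝒢.α y g)))⁻¹}

/-- The group `F(G,Y)`, generated by the vertex groups and the edges subject to `y ȳ = 1` and
`y (g ω_y) ȳ = g α_y`. -/
abbrev F : Type _ := 𝒢.FreeProd ⧸ Subgroup.normalClosure 𝒢.relators

/-- The image in `F(G,Y)` of an element of a vertex group. -/
def ofVertex (a : V) : 𝒢.G a →* 𝒢.F :=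
  (QuotientGroup.mk' _).comp (Monoid.Coprod.inl.comp Monoid.CoprodI.of)

/-- The image in `F(G,Y)` of an edge. -/
def ofEdge (y : ε × Bool) : 𝒢.F :=
  QuotientGroup.mk' _ (Monoid.Coprod.inr (FreeGroup.of y))

theorem ofEdge_mul_bar (y : ε × Bool) : 𝒢.ofEdge y * 𝒢.ofEdge (bar y) = 1 := by
  unfold ofEdge
  rw [← map_mul, QuotientGroup.mk'_apply, QuotientGroup.eq_one_iff]
  exact Subgroup.subset_normalClosure (Or.inl ⟨y, rfl⟩)

/-- Words whose letters are edges and letters from alphabets `X a` attached to the vertices. -/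
abbrev Words (V : Type u) (ε : Type v) (X : V → Type*) : Type _ :=
  List ((Σ a, X a) ⊕ (ε × Bool))

/-- `𝒢.IsPathWord a b l`: the word `l` is of the form `w₀ y₁ w₁ ⋯ yₙ wₙ`, where `y₁ ⋯ yₙ` is an
edge path from `a` to `b`, `w₀` is a word over the alphabet at `a` and `wᵢ` a word over
the alphabet at the end of `yᵢ`. If `a = b`, these are the words of cycle type at `a`. -/
def IsPathWord {X : V → Type*} : V → V → Words V ε X → Prop
  | a, b, [] => a = b
  | a, b, Sum.inl s :: l => s.1 = a ∧ IsPathWord a b l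
  | a, b, Sum.inr y :: l => 𝒢.src y = a ∧ IsPathWord (𝒢.tgt y) b l

/-- The value in `F(G,Y)` of a word, the vertex letters being interpreted by `gen`. -/
def eval {X : V → Type*} (gen : ∀ a, X a → 𝒢.G a) (l : Words V ε X) : 𝒢.F :=
  (l.map (Sum.elim (fun s => 𝒢.ofVertex s.1 (gen s.1 s.2)) 𝒢.ofEdge)).prod

/-- The value of a word whose vertex letters are elements of the vertex groups. -/
abbrev evalG (l : Words V ε 𝒢.G) : 𝒢.F := 𝒢.eval (fun _ g => g) l

theorem IsPathWord.append {X : V → Type*} {a b c : V} {l l' : Words V ε X}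
    (h : 𝒢.IsPathWord a b l) (h' : 𝒢.IsPathWord b c l') : 𝒢.IsPathWord a c (l ++ l') := by
  induction l generalizing a with
  | nil => cases h; exact h'
  | cons s l ih =>
    cases s with
    | inl s => exact ⟨h.1, ih h.2⟩
    | inr y => exact ⟨h.1, ih h.2⟩

theorem exists_inv_word {a b : V} {l : Words V ε 𝒢.G} (h : 𝒢.IsPathWord a b l) :
    ∃ l', 𝒢.IsPathWord b a l' ∧ 𝒢.evalG l' = (𝒢.evalG l)⁻¹ := by
  induction l generalizing a with
  | nil =>
    cases h
    exact ⟨[], rfl, by simp [eval]⟩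
  | cons s l ih =>
    cases s with
    | inl s =>
      obtain ⟨s, g⟩ := s
      obtain ⟨rfl, h2⟩ := h
      obtain ⟨l', h', e⟩ := ih h2
      refine ⟨l' ++ [Sum.inl ⟨s, g⁻¹⟩], h'.append 𝒢 ⟨rfl, rfl⟩, ?_⟩
      simp [eval] at e ⊢
      rw [e]
    | inr y =>
      obtain ⟨rfl, h2⟩ := h
      obtain ⟨l', h', e⟩ := ih h2
      refine ⟨l' ++ [Sum.inr (bar y)], h'.append 𝒢 ⟨rfl, ?_⟩, ?_⟩
      · show 𝒢.src (bar (bar y)) = 𝒢.src y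
        rw [bar_bar]
      · have hb : 𝒢.ofEdge (bar y) = (𝒢.ofEdge y)⁻¹ :=
          eq_inv_of_mul_eq_one_right (𝒢.ofEdge_mul_bar y)
        simp [eval] at e ⊢
        rw [e, hb]

/-- The fundamental group `π₁(G,Y,v₀)`: the subgroup of `F(G,Y)` of all values of words of
cycle type at `v₀`. -/
def fundamentalGroup (v₀ : V) : Subgroup 𝒢.F where
  carrier := {x | ∃ l : Words V ε 𝒢.G, 𝒢.IsPathWord v₀ v₀ l ∧ 𝒢.evalG l = x}
  mul_mem' := by
    rintro _ _ ⟨l, h, rfl⟩ ⟨l', h', rfl⟩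
    exact ⟨l ++ l', h.append 𝒢 h', by simp [eval]⟩
  one_mem' := ⟨[], rfl, by simp [eval]⟩
  inv_mem' := by
    rintro _ ⟨l, h, rfl⟩
    exact 𝒢.exists_inv_word h

/-! ## Finite descriptions -/

/-- Raw finite data describing a graph of groups with vertices `0, …, k - 1` and finite edge
groups, and finitely many elements of its fundamental group (see `Description.code`). -/
abbrev RawDescription : Type :=
  List ℕ × List ((ℕ × ℕ) × List (List ℕ × List ℕ)) × ℕ × List (List ((ℕ × ℕ) ⊕ (ℕ × Bool)))

variable {k m : ℕ}

/-- A finite description of a graph of groups on the vertices `0, …, k - 1` and with edges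
`(0, ±), …, (m - 1, ±)`, over fixed finite monoid generating families of the vertex groups and of
the fundamental group. -/
structure Description (𝒢 : GraphOfGroups.{0, 0, w, x} (Fin k) (Fin m)) (v₀ : Fin k) where
  /-- the numbers of generators of the vertex groups -/
  n : Fin k → ℕ
  /-- the generators of the vertex groups -/
  gen : ∀ a, Fin (n a) → 𝒢.G a
  gen_generates : ∀ a, RatSub.Generates (gen a)
  /-- for every edge, words representing the images of the elements of the edge group at its
  start and at its end -/
  edgeWords : ∀ e : Fin m,
    List (List (Fin (n (𝒢.src (e, true)))) × List (Fin (n (𝒢.src (e, false)))))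
  edgeWords_spec : ∀ e,
    {p | ∃ q ∈ edgeWords e, p = (RatSub.wordVal (gen _) q.1, RatSub.wordVal (gen _) q.2)} =
      Set.range fun g : 𝒢.K e => (𝒢.α (e, true) g, 𝒢.α (e, false) g)
  /-- the number of generators of the fundamental group -/
  r : ℕ
  /-- the generators of the fundamental group -/
  piGen : Fin r → 𝒢.fundamentalGroup v₀
  piGen_generates : RatSub.Generates piGen
  /-- words of cycle type representing the generators of the fundamental group -/
  piWord : Fin r → Words (Fin k) (Fin m) (fun a => Fin (n a))
  piWord_cycle : ∀ j, 𝒢.IsPathWord v₀ v₀ (piWord j)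
  piWord_eval : ∀ j, 𝒢.eval gen (piWord j) = piGen j

namespace Description

variable {𝒢 : GraphOfGroups.{0, 0, w, x} (Fin k) (Fin m)} {v₀ : Fin k}

/-- The finite data in a description: the numbers of generators of the vertex groups; for every
`e < m` the start and the end of the edge `(e, true)` and the words describing the two
embeddings of its edge group; the base vertex; and the words representing the generators of the
fundamental group, in which `(a, i)` is the `i`-th generator at the vertex `a` and `(e, b)` is an
edge. -/
def code (D : Description 𝒢 v₀) : RawDescription :=
  (List.ofFn D.n,
   List.ofFn fun e => (((𝒢.src (e, true) : ℕ), (𝒢.src (e, false) : ℕ)),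
     (D.edgeWords e).map fun q => (q.1.map Fin.val, q.2.map Fin.val)),
   (v₀ : ℕ),
   List.ofFn fun j => (D.piWord j).map
     (Sum.map (fun s => ((s.1 : ℕ), (s.2 : ℕ))) (fun y => ((y.1 : ℕ), y.2))))

/-- Words over the generators of the fundamental group which represent, simultaneously for all
generators at a vertex `a`, their images under the embedding of the vertex group into
`π₁(G,Y,v₀)` that conjugates by (the value of) a path from `v₀` to `a`. -/
structure VertexWords (D : Description 𝒢 v₀) where
  word : ∀ a, Fin (D.n a) → List (Fin D.r)
  spec : ∀ a, ∃ l : Words (Fin k) (Fin m) 𝒢.G, 𝒢.IsPathWord v₀ a l ∧ ∀ i,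
    ((RatSub.wordVal D.piGen (word a i) : 𝒢.fundamentalGroup v₀) : 𝒢.F) =
      𝒢.evalG l * 𝒢.ofVertex a (D.gen a i) * (𝒢.evalG l)⁻¹

/-- The finite data in a family of vertex words. -/
def VertexWords.code {D : Description 𝒢 v₀} (T : D.VertexWords) : List (List (List ℕ)) :=
  List.ofFn fun a => List.ofFn fun i => (T.word a i).map Fin.val

end Description

end GraphOfGroups

/-!
Let `F` be the group generated by the vertex groups and the edges of a graph of groups.

*Normal forms.* The relations of `F` also hold in the multiple HNN extension of the direct product
of all vertex groups, with the edges as stable letters. This extension acts on normal forms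
(`GraphOfGroups.action`), and following the empty normal form under the action of a word proves
Britton's lemma `GraphOfGroups.britton`: if a word along an edge path has its value in a vertex
group, then it contains no edges or it contains a pinch `y (g ω_y) ȳ`, which may be replaced by
`g α_y`. In particular, the vertex groups embed in `F`, and conjugating by the value of a path
embeds them in the fundamental group. Rational subset problems can be pulled back along such an
embedding by substituting words for letters (`RatSub.exists_pullback_program`).

*Saturation.* Conversely, to decide whether `w` lies in the rational subset recognised by an
automaton `A`, replace the labels of `A` by words of cycle type, subdivide, and put a word for `w⁻¹`
in front of the initial state. The question becomes whether `1` is the label of an accepting path in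
the expanded automaton. Whenever this automaton has edges `p →y p'` and `q' →ȳ q` such that `g ω_y`
is the label of a path from `p'` to `q'` with labels in the vertex group at the end of `y`,
add an edge from `p` to `q` labelled by `g α_y`. Since the edge groups are finite, only finitely
many edges can be added, and whether to add one is an instance of the rational subset problem of a
vertex group. By Britton's lemma, over the saturated automaton every label in a vertex group is
already the label of a path inside that vertex group (`GraphOfGroups.Coding.Closed.exists_run`), so
that one more question to the vertex group at the base vertex decides the instance
(`GraphOfGroups.Coding.exists_holds_iff`).

*Computability.* Instead of the saturation procedure itself, only the check of a certificate, made of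
the inverse word, the list of added edges and a time bound for the programs of the vertex groups,
has to be shown primitive recursive. Every correct certificate gives the right answer
(`GraphOfGroups.Coding.answer_sound`), and there is one that gives an answer
(`GraphOfGroups.Coding.exists_answer`), so an unbounded search decides the problem, uniformly in the
description (`GraphOfGroups.exists_uniform_program`). To cover graphs of groups in all universes,
descriptions are related to graphs of groups through numberings of the vertices and edges
(`GraphOfGroups.Coding`).
-/

/-! ### Normal forms in multiple HNN extensions -/

namespace MultiHNN

open GraphOfGroups (bar bar_bar)

variable {ε : Type*} {B : Type*} [Group B] {K : ε → Type*} [∀ e, Group (K e)]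

/-- The embedding of an edge group at the end of the edge. Unlike for `β (bar y)`, its domain is
syntactically that of `β y`. -/
def tgtEmb (β : ∀ y : ε × Bool, K y.1 →* B) (y : ε × Bool) : K y.1 →* B := β (bar y)

theorem tgtEmb_injective {β : ∀ y : ε × Bool, K y.1 →* B} (hβ : ∀ y, Function.Injective (β y))
    (y : ε × Bool) : Function.Injective (tgtEmb β y) := hβ (bar y)

theorem tgtEmb_bar (β : ∀ y : ε × Bool, K y.1 →* B) (y : ε × Bool) (k : K y.1) :
    tgtEmb β (bar y) k = β y k := by
  obtain ⟨e, b⟩ := y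
  cases b <;> rfl

/-- For every edge `y`, a right transversal of the subgroup `tgtEmb β y` of `B`, presented by the
two components of the resulting decomposition `g = tgtEmb β y (kp y g) * tp y g`. -/
structure Transversal (β : ∀ y : ε × Bool, K y.1 →* B) where
  kp : ∀ y : ε × Bool, B → K y.1
  tp : ε × Bool → B → B
  decomp : ∀ y g, tgtEmb β y (kp y g) * tp y g = g
  kp_mul : ∀ y k g, kp y (tgtEmb β y k * g) = k * kp y g
  tp_mul : ∀ y k g, tp y (tgtEmb β y k * g) = tp y g
  tp_one : ∀ y, tp y 1 = 1

variable {β : ∀ y : ε × Bool, K y.1 →* B}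

theorem exists_transversal (hβ : ∀ y, Function.Injective (β y)) : Nonempty (Transversal β) := by
  have h1 : ∀ y : ε × Bool, ∃ S : Set B,
      Subgroup.IsComplement ((tgtEmb β y).range : Set B) S ∧ 1 ∈ S :=
    fun y => Subgroup.exists_isComplement_right _ _
  choose S hS h1S using h1
  have h2 : ∀ (y : ε × Bool) (g : B), ∃ k : K y.1, tgtEmb β y k = ((hS y).equiv g).1 :=
    fun y g => ((hS y).equiv g).1.2
  choose kp hkp using h2
  refine ⟨⟨kp, fun y g => ((hS y).equiv g).2, fun y g => ?_, fun y k g => ?_, fun y k g => ?_,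
    fun y => ?_⟩⟩
  · rw [hkp]; exact (hS y).equiv_fst_mul_equiv_snd g
  · apply tgtEmb_injective hβ y
    have := (hS y).equiv_mul_left ⟨tgtEmb β y k, ⟨k, rfl⟩⟩ g
    change (hS y).equiv (tgtEmb β y k * g) = _ at this
    rw [hkp, this, map_mul, hkp]
    rfl
  · have := (hS y).equiv_mul_left ⟨tgtEmb β y k, ⟨k, rfl⟩⟩ g
    change (hS y).equiv (tgtEmb β y k * g) = _ at this
    simp only [this]
  · exact congrArg Subtype.val
      ((hS y).equiv_snd_eq_one_of_mem_of_one_mem (h1S y) (one_mem _))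

namespace Transversal

variable (τ : Transversal β)

theorem kp_of_tp {y : ε × Bool} {t : B} (hβ : ∀ y, Function.Injective (β y))
    (h : τ.tp y t = t) : τ.kp y t = 1 := by
  have := τ.decomp y t
  rw [h] at this
  apply tgtEmb_injective hβ y
  rw [map_one]
  exact mul_eq_right.mp this

theorem tp_tp (y : ε × Bool) (g : B) : τ.tp y (τ.tp y g) = τ.tp y g := by
  conv_rhs => rw [← τ.decomp y g, τ.tp_mul]

theorem tp_image (y : ε × Bool) (k : K y.1) : τ.tp y (tgtEmb β y k) = 1 := by
  rw [← mul_one (tgtEmb β y k), τ.tp_mul, τ.tp_one]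

theorem kp_image (hβ : ∀ y, Function.Injective (β y)) (y : ε × Bool) (k : K y.1) :
    τ.kp y (tgtEmb β y k) = k := by
  rw [← mul_one (tgtEmb β y k), τ.kp_mul, τ.kp_of_tp hβ (τ.tp_one y), mul_one]

/-- The tails `y₁ t₁ ⋯ yₙ tₙ` of normal forms: each `tᵢ` is in the transversal belonging to `yᵢ`,
and `tᵢ ≠ 1` where `yᵢ₊₁` is inverse to `yᵢ`. -/
def Reduced : List ((ε × Bool) × B) → Prop
  | [] => True
  | (y, t) :: r => τ.tp y t = t ∧ (∀ t' r', r = (bar y, t') :: r' → t ≠ 1) ∧ Reduced r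

/-- A normal form `g y₁ t₁ ⋯ yₙ tₙ`, with `g : B` arbitrary. -/
abbrev NormalForm : Type _ := {x : B × List ((ε × Bool) × B) // τ.Reduced x.2}

open Classical in
/-- Left multiplication of a normal form by the edge `y`: write the first component as
`β (bar y) k * t`, move `k` across `y`, and cancel `y` against a following `bar y` if `t = 1`. -/
noncomputable def step (y : ε × Bool) : B × List ((ε × Bool) × B) → B × List ((ε × Bool) × B)
  | (g, []) => (β y (τ.kp y g), [(y, τ.tp y g)])
  | (g, (z, t) :: r) =>
      if τ.tp y g = 1 ∧ z = bar y then (β y (τ.kp y g) * t, r)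
      else (β y (τ.kp y g), (y, τ.tp y g) :: (z, t) :: r)

theorem step_cancel {y : ε × Bool} {g : B} (h : τ.tp y g = 1) (t : B)
    (r : List ((ε × Bool) × B)) :
    τ.step y (g, (bar y, t) :: r) = (β y (τ.kp y g) * t, r) := by
  simp [step, h]

theorem step_push {y : ε × Bool} {g : B} {r : List ((ε × Bool) × B)}
    (h : ∀ t' r', r = (bar y, t') :: r' → τ.tp y g ≠ 1) :
    τ.step y (g, r) = (β y (τ.kp y g), (y, τ.tp y g) :: r) := by
  cases r with
  | nil => rfl
  | cons z r =>
    obtain ⟨z, t⟩ := z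
    rw [step, if_neg]
    rintro ⟨h1, rfl⟩
    exact h t r rfl h1

theorem step_cases (y : ε × Bool) (g : B) (r : List ((ε × Bool) × B)) :
    (τ.tp y g = 1 ∧ ∃ t r', r = (bar y, t) :: r') ∨
      ∀ t' r', r = (bar y, t') :: r' → τ.tp y g ≠ 1 := by
  by_cases h : τ.tp y g = 1 ∧ ∃ t r', r = (bar y, t) :: r'
  · exact Or.inl h
  · exact Or.inr fun t r' hr h1 => h ⟨h1, t, r', hr⟩

theorem reduced_step (y : ε × Bool) (x : B × List ((ε × Bool) × B)) (hx : τ.Reduced x.2) :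
    τ.Reduced (τ.step y x).2 := by
  obtain ⟨g, r⟩ := x
  obtain ⟨h, t, r', rfl⟩ | h := τ.step_cases y g r
  · rw [τ.step_cancel h]
    exact hx.2.2
  · rw [τ.step_push h]
    exact ⟨τ.tp_tp y g, h, hx⟩

/-- The steps of inverse edges undo each other. This needs the condition on adjacent inverse edges
in `Reduced`: without it, undoing a cancellation might cancel again. -/
theorem step_step (hβ : ∀ y, Function.Injective (β y)) (y : ε × Bool)
    (x : B × List ((ε × Bool) × B)) (hx : τ.Reduced x.2) :
    τ.step (bar y) (τ.step y x) = x := by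
  have hbb := tgtEmb_bar β y
  obtain ⟨g, r⟩ := x
  obtain ⟨h, t, r', rfl⟩ | h := τ.step_cases y g r
  · have hd := τ.decomp y g
    rw [h, mul_one] at hd
    have e1 : τ.kp (bar y) (β y (τ.kp y g) * t) = τ.kp y g := by
      have := τ.kp_mul (bar y) (τ.kp y g) t
      rw [hbb, τ.kp_of_tp hβ hx.1] at this
      exact this.trans (mul_one (τ.kp y g))
    have e2 : τ.tp (bar y) (β y (τ.kp y g) * t) = t := by
      have := τ.tp_mul (bar y) (τ.kp y g) t
      rwa [hbb, hx.1] at this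
    rw [τ.step_cancel h, τ.step_push, e1, e2]
    · exact Prod.ext hd rfl
    intro t' r'' hr
    rw [e2]
    exact hx.2.1 t' r'' hr
  · have e1 : τ.kp (bar y) (β y (τ.kp y g)) = τ.kp y g := by
      have := τ.kp_image hβ (bar y) (τ.kp y g)
      rwa [hbb] at this
    have e2 : τ.tp (bar y) (β y (τ.kp y g)) = 1 := by
      have := τ.tp_image (bar y) (τ.kp y g)
      rwa [hbb] at this
    rw [τ.step_push h]
    have := τ.step_cancel e2 (τ.tp y g) r
    rw [bar_bar] at this
    rw [this, e1]
    exact Prod.ext (τ.decomp y g) rfl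

theorem step_mul (y : ε × Bool) (k : K y.1) (g : B) (r : List ((ε × Bool) × B)) :
    τ.step y (tgtEmb β y k * g, r) = (β y k * (τ.step y (g, r)).1, (τ.step y (g, r)).2) := by
  obtain ⟨h, t, r', rfl⟩ | h := τ.step_cases y g r
  · rw [τ.step_cancel h, τ.step_cancel (by rw [τ.tp_mul, h]), τ.kp_mul, map_mul, mul_assoc]
  · rw [τ.step_push h, τ.step_push (by rwa [τ.tp_mul]), τ.kp_mul, τ.tp_mul, map_mul]

/-- The action of `B` on normal forms by left multiplication. -/
def baseAction : B →* Equiv.Perm τ.NormalForm where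
  toFun b :=
    { toFun := fun x => ⟨(b * x.1.1, x.1.2), x.2⟩
      invFun := fun x => ⟨(b⁻¹ * x.1.1, x.1.2), x.2⟩
      left_inv := fun x => by simp
      right_inv := fun x => by simp }
  map_one' := by ext x <;> simp
  map_mul' a b := by ext x <;> simp [mul_assoc]

/-- The permutation of the normal forms induced by an edge. -/
noncomputable def edgeAction (hβ : ∀ y, Function.Injective (β y)) (y : ε × Bool) :
    Equiv.Perm τ.NormalForm where
  toFun x := ⟨τ.step y x.1, τ.reduced_step y x.1 x.2⟩
  invFun x := ⟨τ.step (bar y) x.1, τ.reduced_step (bar y) x.1 x.2⟩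
  left_inv x := Subtype.ext (τ.step_step hβ y x.1 x.2)
  right_inv x := Subtype.ext (by
    have := τ.step_step hβ (bar y) x.1 x.2
    rwa [bar_bar] at this)

end Transversal

end MultiHNN

/-! ### Britton's lemma -/

namespace GraphOfGroups

variable {V : Type u} {ε : Type v} (𝒢 : GraphOfGroups.{u, v, w, x} V ε)

open MultiHNN

/-- The embedding of a vertex group into the direct product of all vertex groups. -/
noncomputable def single (a : V) : 𝒢.G a →* ∀ a, 𝒢.G a :=
  letI := Classical.decEq V
  MonoidHom.mulSingle 𝒢.G a

theorem single_injective (a : V) : Function.Injective (𝒢.single a) :=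
  letI := Classical.decEq V
  Pi.mulSingle_injective a

/-- The embedding of an edge group into the direct product of all vertex groups. -/
noncomputable def edgeEmb (y : ε × Bool) : 𝒢.K y.1 →* ∀ a, 𝒢.G a :=
  (𝒢.single (𝒢.src y)).comp (𝒢.α y)

theorem edgeEmb_injective (y : ε × Bool) : Function.Injective (𝒢.edgeEmb y) :=
  (𝒢.single_injective _).comp (𝒢.α_injective y)

/-- `F(G,Y)` acts on the normal forms of the multiple HNN extension, with stable letters the
edges, of the direct product of the vertex groups. -/
noncomputable def action (τ : Transversal 𝒢.edgeEmb) : 𝒢.F →* Equiv.Perm τ.NormalForm :=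
  QuotientGroup.lift _
    (Monoid.Coprod.lift (Monoid.CoprodI.lift fun a => τ.baseAction.comp (𝒢.single a))
      (FreeGroup.lift (τ.edgeAction 𝒢.edgeEmb_injective)))
    (by
      have key : ∀ y, τ.edgeAction 𝒢.edgeEmb_injective y *
          τ.edgeAction 𝒢.edgeEmb_injective (bar y) = 1 := by
        intro y
        ext1 x
        exact (τ.edgeAction 𝒢.edgeEmb_injective y).right_inv x
      have key2 : ∀ (y) (k : 𝒢.K y.1), τ.edgeAction 𝒢.edgeEmb_injective y *
          τ.baseAction (𝒢.single _ (𝒢.ω y k)) =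
          τ.baseAction (𝒢.single _ (𝒢.α y k)) * τ.edgeAction 𝒢.edgeEmb_injective y := by
        intro y k
        ext1 x
        exact Subtype.ext (τ.step_mul y k x.1.1 x.1.2)
      refine Subgroup.normalClosure_le_normal ?_
      rintro _ (⟨y, rfl⟩ | ⟨y, k, rfl⟩)
      · simp [MonoidHom.mem_ker, key]
      · rw [SetLike.mem_coe, MonoidHom.mem_ker]
        simp only [map_mul, map_inv, Monoid.Coprod.lift_apply_inl, Monoid.Coprod.lift_apply_inr,
          Monoid.CoprodI.lift_of, FreeGroup.lift_apply_of, MonoidHom.comp_apply]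
        rw [key2, mul_assoc _ _ (τ.edgeAction _ (bar y)), key, mul_one, mul_inv_cancel])

theorem action_ofVertex (τ : Transversal 𝒢.edgeEmb) (a : V) (g : 𝒢.G a) :
    𝒢.action τ (𝒢.ofVertex a g) = τ.baseAction (𝒢.single a g) := by
  simp [action, ofVertex]

theorem action_ofEdge (τ : Transversal 𝒢.edgeEmb) (y : ε × Bool) :
    𝒢.action τ (𝒢.ofEdge y) = τ.edgeAction 𝒢.edgeEmb_injective y := by
  simp [action, ofEdge]

/-- The empty normal form. -/
def baseForm (τ : Transversal 𝒢.edgeEmb) : τ.NormalForm := ⟨(1, []), trivial⟩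

theorem action_ofVertex_baseForm (τ : Transversal 𝒢.edgeEmb) (a : V) (g : 𝒢.G a) :
    (𝒢.action τ (𝒢.ofVertex a g) (𝒢.baseForm τ)).1 = (𝒢.single a g, []) := by
  rw [action_ofVertex]
  exact Prod.ext (mul_one _) rfl

theorem ofVertex_injective (a : V) : Function.Injective (𝒢.ofVertex a) := by
  obtain ⟨τ⟩ := exists_transversal 𝒢.edgeEmb_injective
  intro g h e
  have := 𝒢.action_ofVertex_baseForm τ a g
  rw [e, action_ofVertex_baseForm] at this
  exact 𝒢.single_injective a (congrArg Prod.fst this).symm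

/-- The value of a list of vertex letters in the direct product of all vertex groups. -/
noncomputable def singleVal (l : List (Σ a, 𝒢.G a)) : ∀ a, 𝒢.G a :=
  (l.map fun s => 𝒢.single s.1 s.2).prod

/-- A word containing a subword `y g ȳ` where `g` is in the image of the edge group of `y`. -/
def HasPinch (l : Words V ε 𝒢.G) : Prop :=
  ∃ (l₁ : Words V ε 𝒢.G) (y : ε × Bool) (m : List (Σ a, 𝒢.G a)) (l₂ : Words V ε 𝒢.G)
    (k : 𝒢.K y.1), l = l₁ ++ Sum.inr y :: (m.map Sum.inl ++ Sum.inr (bar y) :: l₂) ∧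
      𝒢.singleVal m = tgtEmb 𝒢.edgeEmb y k

theorem HasPinch.cons {l : Words V ε 𝒢.G} (h : 𝒢.HasPinch l) (s) : 𝒢.HasPinch (s :: l) := by
  obtain ⟨l₁, y, m, l₂, k, rfl, h⟩ := h
  exact ⟨s :: l₁, y, m, l₂, k, rfl, h⟩

/-- A word without pinches has a normal form with the same edges, and up to the image of the
edge group of the first edge with the same vertex letters in front of this edge. -/
theorem action_eval_of_not_hasPinch (τ : Transversal 𝒢.edgeEmb) (l : Words V ε 𝒢.G) :
    𝒢.HasPinch l ∨
    (∃ m : List (Σ a, 𝒢.G a), l = m.map Sum.inl ∧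
      (𝒢.action τ (𝒢.evalG l) (𝒢.baseForm τ)).1 = (𝒢.singleVal m, [])) ∨
    (∃ (m : List (Σ a, 𝒢.G a)) (y : ε × Bool) (l' : Words V ε 𝒢.G) (k : 𝒢.K y.1)
      (t : ∀ a, 𝒢.G a) (r : _), l = m.map Sum.inl ++ Sum.inr y :: l' ∧
      (𝒢.action τ (𝒢.evalG l) (𝒢.baseForm τ)).1 =
        (𝒢.singleVal m * 𝒢.edgeEmb y k, (y, t) :: r)) := by
  induction l with
  | nil => exact Or.inr (Or.inl ⟨[], rfl, by simp [eval, singleVal, baseForm]⟩)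
  | cons s l ih =>
    have hact : 𝒢.action τ (𝒢.evalG (s :: l)) (𝒢.baseForm τ) =
        𝒢.action τ (Sum.elim (fun s => 𝒢.ofVertex s.1 s.2) 𝒢.ofEdge s)
          (𝒢.action τ (𝒢.evalG l) (𝒢.baseForm τ)) := by
      simp [eval]
    rw [hact]
    obtain h | h := ih
    · exact Or.inl (h.cons 𝒢 s)
    generalize 𝒢.action τ (𝒢.evalG l) (𝒢.baseForm τ) = X at h
    cases s with
    | inl s =>
      rw [Sum.elim_inl, action_ofVertex]
      obtain ⟨m, hm, hX⟩ | ⟨m, y, l', k, t, r, hm, hX⟩ := h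
      · refine Or.inr (Or.inl ⟨s :: m, by rw [hm]; rfl, ?_⟩)
        change (𝒢.single s.1 s.2 * X.1.1, X.1.2) = _
        rw [hX]; simp [singleVal]
      · refine Or.inr (Or.inr ⟨s :: m, y, l', k, t, r, by rw [hm]; rfl, ?_⟩)
        change (𝒢.single s.1 s.2 * X.1.1, X.1.2) = _
        rw [hX]; simp [singleVal, mul_assoc]
    | inr y =>
      rw [Sum.elim_inr, action_ofEdge]
      change _ ∨ (∃ m : List (Σ a, 𝒢.G a), _ ∧ τ.step y X.1 = _) ∨
        (∃ m y' l' k t r, _ ∧ τ.step y X.1 = _)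
      obtain ⟨⟨g, rX⟩, hXr⟩ := X
      obtain ⟨h1, t, r', hr'⟩ | h1 := τ.step_cases y g rX
      -- The normal form gets shorter only if the word begins with a pinch.
      · obtain ⟨m, hm, hX⟩ | ⟨m, y', l', k, t', r, hm, hX⟩ := h
        · simp only [Prod.mk.injEq] at hX
          rw [hX.2] at hr'
          cases hr'
        · simp only [Prod.mk.injEq] at hX
          obtain ⟨hg, rfl⟩ := hX
          simp only [List.cons.injEq, Prod.mk.injEq] at hr'
          obtain ⟨⟨rfl, -⟩, -⟩ := hr'
          have hd := τ.decomp y g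
          rw [h1, mul_one, hg] at hd
          refine Or.inl ⟨[], y, m, l', τ.kp y g * (show 𝒢.K y.1 from k)⁻¹, by rw [hm]; rfl, ?_⟩
          rw [map_mul]
          rw [hg, hd, map_inv]
          exact (mul_inv_cancel_right _ _).symm
      · refine Or.inr (Or.inr ⟨[], y, l, τ.kp y g, τ.tp y g, rX, rfl, ?_⟩)
        rw [τ.step_push h1]
        simp [singleVal]

theorem singleVal_of_isPathWord {a b : V} (m : List (Σ a, 𝒢.G a)) (l : Words V ε 𝒢.G)
    (h : 𝒢.IsPathWord a b (m.map Sum.inl ++ l)) :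
    ∃ g : 𝒢.G a, 𝒢.singleVal m = 𝒢.single a g ∧ 𝒢.IsPathWord a b l ∧
      𝒢.evalG (m.map Sum.inl) = 𝒢.ofVertex a g := by
  induction m with
  | nil => exact ⟨1, by simp [singleVal], h, by simp [eval]⟩
  | cons s m ih =>
    obtain ⟨c, s⟩ := s
    obtain ⟨rfl, h2⟩ := h
    obtain ⟨g, h3, h4, h5⟩ := ih h2
    refine ⟨s * g, ?_, h4, ?_⟩
    · rw [map_mul, ← h3]; simp [singleVal]
    · rw [map_mul, ← h5]; simp [eval]

theorem IsPathWord.split {X : V → Type*} {a b : V} {l l' : Words V ε X}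
    (h : 𝒢.IsPathWord a b (l ++ l')) : ∃ c, 𝒢.IsPathWord a c l ∧ 𝒢.IsPathWord c b l' := by
  induction l generalizing a with
  | nil => exact ⟨a, rfl, h⟩
  | cons s l ih =>
    cases s with
    | inl s => obtain ⟨c, h1, h2⟩ := ih h.2; exact ⟨c, ⟨h.1, h1⟩, h2⟩
    | inr s => obtain ⟨c, h1, h2⟩ := ih h.2; exact ⟨c, ⟨h.1, h1⟩, h2⟩

/-- Britton's lemma: a word along an edge path that represents an element of a vertex group
contains no edges, or it contains a subword `y g ȳ` with `g` in the image of the edge group. -/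
theorem britton {a b c : V} {l : Words V ε 𝒢.G} (hl : 𝒢.IsPathWord a b l) (g : 𝒢.G c)
    (hg : 𝒢.evalG l = 𝒢.ofVertex c g) :
    (∃ m : List (Σ a, 𝒢.G a), l = m.map Sum.inl) ∨
    ∃ (l₁ : Words V ε 𝒢.G) (y : ε × Bool) (m : List (Σ a, 𝒢.G a)) (l₂ : Words V ε 𝒢.G)
      (k : 𝒢.K y.1), l = l₁ ++ Sum.inr y :: (m.map Sum.inl ++ Sum.inr (bar y) :: l₂) ∧
        𝒢.evalG (m.map Sum.inl) = 𝒢.ofVertex (𝒢.tgt y) (𝒢.ω y k) := by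
  obtain ⟨τ⟩ := exists_transversal 𝒢.edgeEmb_injective
  obtain ⟨l₁, y, m, l₂, k, rfl, hk⟩ | ⟨m, hm, -⟩ | ⟨m, y, l', k, t, r, hm, hX⟩ :=
    𝒢.action_eval_of_not_hasPinch τ l
  · refine Or.inr ⟨l₁, y, m, l₂, k, rfl, ?_⟩
    obtain ⟨d, -, -, h2⟩ := hl.split 𝒢
    obtain ⟨g, h3, -, h4⟩ := 𝒢.singleVal_of_isPathWord m _ h2
    rw [h4]
    congr 1
    apply 𝒢.single_injective
    rw [← h3, hk]
    rfl
  · exact Or.inl ⟨m, hm⟩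
  · rw [hg, action_ofVertex_baseForm] at hX
    simp at hX


end GraphOfGroups

/-! ### Codings -/

namespace GraphOfGroups

open RatSub

/-- A transition labelled by a word over the generators of a vertex group:
`(vertex, state, word, state)`. -/
abbrev Item : Type := ℕ × ℕ × List ℕ × ℕ

/-- A transition labelled by an edge: `(state, edge, state)`. -/
abbrev EdgeStep : Type := ℕ × (ℕ × Bool) × ℕ

/-- Letters of raw words: `(a, i)` is the `i`-th generator at the vertex `a`, and `(e, b)` is an
edge. -/
abbrev RawLetter : Type := (ℕ × ℕ) ⊕ (ℕ × Bool)

variable {V : Type u} {ε : Type v}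

/-- The raw data `d` describe the graph of groups `𝒢` and generators of its fundamental group,
once vertices and edges are numbered. In contrast to `Description`, the vertices and edges may
live in any universe. -/
structure Coding (𝒢 : GraphOfGroups.{u, v, w, x} V ε) (v₀ : V) (d : RawDescription) where
  /-- the numbers of the vertices -/
  nv : V → ℕ
  nv_injective : Function.Injective nv
  /-- the numbers of the edges -/
  ne : ε → ℕ
  ne_injective : Function.Injective ne
  n : V → ℕ
  gen : ∀ a, Fin (n a) → 𝒢.G a
  gen_generates : ∀ a, Generates (gen a)
  edgeWords : ∀ e : ε,
    List (List (Fin (n (𝒢.src (e, true)))) × List (Fin (n (𝒢.src (e, false)))))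
  edgeWords_spec : ∀ e,
    {p | ∃ q ∈ edgeWords e, p = (wordVal (gen _) q.1, wordVal (gen _) q.2)} =
      Set.range fun g : 𝒢.K e => (𝒢.α (e, true) g, 𝒢.α (e, false) g)
  r : ℕ
  piGen : Fin r → 𝒢.fundamentalGroup v₀
  piWord : Fin r → Words V ε (fun a => Fin (n a))
  piWord_cycle : ∀ j, 𝒢.IsPathWord v₀ v₀ (piWord j)
  piWord_eval : ∀ j, 𝒢.eval gen (piWord j) = piGen j
  n_eq : ∀ a, d.1[nv a]? = some (n a)
  edge_eq : ∀ e, d.2.1[ne e]? = some ((nv (𝒢.src (e, true)), nv (𝒢.src (e, false))),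
    (edgeWords e).map fun q => (q.1.map Fin.val, q.2.map Fin.val))
  base_eq : d.2.2.1 = nv v₀
  word_eq : ∀ j : Fin r, d.2.2.2[(j : ℕ)]? = some ((piWord j).map
    (Sum.map (fun s => (nv s.1, (s.2 : ℕ))) (fun y => (ne y.1, y.2))))

variable {𝒢 : GraphOfGroups.{u, v, w, x} V ε} {v₀ : V} {d : RawDescription}

/-! ### Paths in automata over a graph of groups -/

theorem ofEdge_mul_ofVertex_mul_bar (y : ε × Bool) (k : 𝒢.K y.1) :
    𝒢.ofEdge y * 𝒢.ofVertex _ (𝒢.ω y k) * 𝒢.ofEdge (bar y) = 𝒢.ofVertex _ (𝒢.α y k) := by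
  rw [← mul_inv_eq_one]
  unfold ofEdge ofVertex
  simp only [MonoidHom.comp_apply]
  rw [← map_mul, ← map_mul, ← map_inv, ← map_mul, QuotientGroup.mk'_apply,
    QuotientGroup.eq_one_iff]
  exact Subgroup.subset_normalClosure (Or.inr ⟨y, k, rfl⟩)

theorem eval_append {X : V → Type*} (gen : ∀ a, X a → 𝒢.G a) (l l' : Words V ε X) :
    𝒢.eval gen (l ++ l') = 𝒢.eval gen l * 𝒢.eval gen l' := by
  simp [eval]

theorem eval_inr_cons {X : V → Type*} (gen : ∀ a, X a → 𝒢.G a) (y : ε × Bool) (l : Words V ε X) :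
    𝒢.eval gen (Sum.inr y :: l) = 𝒢.ofEdge y * 𝒢.eval gen l := by
  simp [eval]

theorem eval_inl_cons {X : V → Type*} (gen : ∀ a, X a → 𝒢.G a) (s : Σ a, X a) (l : Words V ε X) :
    𝒢.eval gen (Sum.inl s :: l) = 𝒢.ofVertex s.1 (gen s.1 s.2) * 𝒢.eval gen l := by
  simp [eval]

theorem eval_nil {X : V → Type*} (gen : ∀ a, X a → 𝒢.G a) : 𝒢.eval gen [] = 1 := by
  simp [eval]

theorem evalG_append (l l' : Words V ε 𝒢.G) : 𝒢.evalG (l ++ l') = 𝒢.evalG l * 𝒢.evalG l' :=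
  eval_append _ l l'

theorem evalG_inr_cons (y : ε × Bool) (l : Words V ε 𝒢.G) :
    𝒢.evalG (Sum.inr y :: l) = 𝒢.ofEdge y * 𝒢.evalG l :=
  eval_inr_cons _ y l

theorem evalG_inl_cons (s : Σ a, 𝒢.G a) (l : Words V ε 𝒢.G) :
    𝒢.evalG (Sum.inl s :: l) = 𝒢.ofVertex s.1 s.2 * 𝒢.evalG l :=
  eval_inl_cons _ s l

theorem evalG_nil : 𝒢.evalG [] = 1 := eval_nil _

namespace Coding

variable (C : Coding 𝒢 v₀ d)

/-- Paths in the automaton with the transitions `T` and `EL`, from a state visited at one vertex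
to a state visited at another; the label is a word along an edge path. -/
inductive PathRun (T : List Item) (EL : List EdgeStep) :
    V → ℕ → V → ℕ → Words V ε 𝒢.G → Prop
  | nil (a : V) (p : ℕ) : PathRun T EL a p a p []
  | vert {a b : V} {p q s : ℕ} {u : List (Fin (C.n a))} {l : Words V ε 𝒢.G}
      (h : (C.nv a, p, u.map Fin.val, q) ∈ T) (hl : PathRun T EL a q b s l) :
      PathRun T EL a p b s (Sum.inl ⟨a, wordVal (C.gen a) u⟩ :: l)
  | edge {y : ε × Bool} {b : V} {p q s : ℕ} {l : Words V ε 𝒢.G}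
      (h : (p, (C.ne y.1, y.2), q) ∈ EL) (hl : PathRun T EL (𝒢.tgt y) q b s l) :
      PathRun T EL (𝒢.src y) p b s (Sum.inr y :: l)

variable {C} {T T' : List Item} {EL : List EdgeStep} {a b c : V} {p q s : ℕ}
  {l l' : Words V ε 𝒢.G}

theorem PathRun.isPathWord (h : C.PathRun T EL a p b q l) : 𝒢.IsPathWord a b l := by
  induction h with
  | nil => rfl
  | vert h hl ih => exact ⟨rfl, ih⟩
  | edge h hl ih => exact ⟨rfl, ih⟩

theorem PathRun.append (h : C.PathRun T EL a p b q l) (h' : C.PathRun T EL b q c s l') :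
    C.PathRun T EL a p c s (l ++ l') := by
  induction h with
  | nil => exact h'
  | vert h hl ih => exact .vert h (ih h')
  | edge h hl ih => exact .edge h (ih h')

theorem PathRun.split (h : C.PathRun T EL a p c s (l ++ l')) :
    ∃ b q, C.PathRun T EL a p b q l ∧ C.PathRun T EL b q c s l' := by
  induction l generalizing a p with
  | nil => exact ⟨a, p, .nil a p, h⟩
  | cons z l ih =>
    cases h with
    | vert h hl =>
      obtain ⟨b, q, h1, h2⟩ := ih hl
      exact ⟨b, q, .vert h h1, h2⟩
    | edge h hl =>
      obtain ⟨b, q, h1, h2⟩ := ih hl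
      exact ⟨b, q, .edge h h1, h2⟩

theorem PathRun.eq_of_map_inl {m : List (Σ a, 𝒢.G a)}
    (h : C.PathRun T EL a p b q (m.map Sum.inl)) : a = b := by
  induction m generalizing a p with
  | nil => cases h; rfl
  | cons s m ih =>
    cases h with
    | vert h hl => exact ih hl

/-- `C.Holds T a p g q`: the element `g` of the vertex group at `a` is the label of a path from `p`
to `q` which uses only the transitions in `T` that belong to `a`. -/
def Holds (C : Coding 𝒢 v₀ d) (T : List Item) (a : V) (p : ℕ) (g : 𝒢.G a) (q : ℕ) : Prop :=
  ∃ m : List (Σ a, 𝒢.G a), C.PathRun T [] a p a q (m.map Sum.inl) ∧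
    𝒢.evalG (m.map Sum.inl) = 𝒢.ofVertex a g

theorem PathRun.of_edges_nil (h : C.PathRun T [] a p b q l) : C.PathRun T EL a p b q l := by
  induction h with
  | nil => exact .nil _ _
  | vert h hl ih => exact .vert h ih
  | edge h hl ih => simp at h

theorem PathRun.to_edges_nil {m : List (Σ a, 𝒢.G a)}
    (h : C.PathRun T EL a p b q (m.map Sum.inl)) : C.PathRun T [] a p b q (m.map Sum.inl) := by
  induction m generalizing a p with
  | nil => cases h; exact .nil _ _
  | cons s m ih =>
    cases h with
    | vert h hl => exact .vert h (ih hl)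

/-- The item `t` is realised by a path in the automaton with transitions `T` and `EL`. -/
def Sound (C : Coding 𝒢 v₀ d) (T : List Item) (EL : List EdgeStep) (t : Item) : Prop :=
  ∀ (a : V) (p : ℕ) (u : List (Fin (C.n a))) (q : ℕ), t = (C.nv a, p, u.map Fin.val, q) →
    ∃ l, C.PathRun T EL a p a q l ∧ 𝒢.evalG l = 𝒢.ofVertex a (wordVal (C.gen a) u)

theorem sound_of_mem {t : Item} (h : t ∈ T) : C.Sound T EL t := by
  rintro a p u q rfl
  exact ⟨_, .vert h (.nil _ _), by simp [eval]⟩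

theorem PathRun.exists_of_sound (hT : ∀ t ∈ T, C.Sound T' EL t) (h : C.PathRun T EL a p b q l) :
    ∃ l', C.PathRun T' EL a p b q l' ∧ 𝒢.evalG l' = 𝒢.evalG l := by
  induction h with
  | nil => exact ⟨[], .nil _ _, rfl⟩
  | vert h hl ih =>
    obtain ⟨l₁, h1, e1⟩ := hT _ h _ _ _ _ rfl
    obtain ⟨l₂, h2, e2⟩ := ih
    exact ⟨l₁ ++ l₂, h1.append h2, by rw [evalG_append, e1, e2, evalG_inl_cons]⟩
  | edge h hl ih =>
    obtain ⟨l₂, h2, e2⟩ := ih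
    exact ⟨_, .edge h h2, by rw [evalG_inr_cons, evalG_inr_cons, e2]⟩

theorem PathRun.mono (hT : T ⊆ T') (h : C.PathRun T EL a p b q l) : C.PathRun T' EL a p b q l := by
  induction h with
  | nil => exact .nil _ _
  | vert h hl ih => exact .vert (hT h) ih
  | edge h hl ih => exact .edge h ih

theorem map_val_injective {n : ℕ} :
    Function.Injective (List.map (Fin.val : Fin n → ℕ)) :=
  List.map_injective_iff.mpr Fin.val_injective

/-! ### Pinches -/

/-- Transitions added for pinches do not change the labels of paths. -/
theorem exists_pinch_run {y : ε × Bool} {p p' q' q : ℕ} {k : 𝒢.K y.1}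
    (hT : ∀ t ∈ T, C.Sound T' EL t)
    (h1 : (p, (C.ne y.1, y.2), p') ∈ EL) (h2 : (q', (C.ne y.1, !y.2), q) ∈ EL)
    (h : C.Holds T (𝒢.tgt y) p' (𝒢.ω y k) q') :
    ∃ l, C.PathRun T' EL (𝒢.src y) p (𝒢.src y) q l ∧
      𝒢.evalG l = 𝒢.ofVertex _ (𝒢.α y k) := by
  obtain ⟨m, hm, e⟩ := h
  obtain ⟨l, hl, e'⟩ := (hm.of_edges_nil (EL := EL)).exists_of_sound hT
  have h3 : C.PathRun T' EL (𝒢.tgt y) q' (𝒢.src y) q [Sum.inr (bar y)] := by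
    refine PathRun.edge (y := bar y) h2 ?_
    have : 𝒢.tgt (bar y) = 𝒢.src y := by rw [tgt, bar_bar]
    rw [this]
    exact .nil _ _
  refine ⟨Sum.inr y :: (l ++ [Sum.inr (bar y)]), .edge h1 (hl.append h3), ?_⟩
  rw [evalG_inr_cons, evalG_append, e', e, ← ofEdge_mul_ofVertex_mul_bar, evalG_inr_cons, evalG_nil,
    mul_one, mul_assoc]

/-- The set `T` of items is closed under the pinches `y (g ω_y) ȳ = g α_y`. -/
def Closed (C : Coding 𝒢 v₀ d) (T : List Item) (EL : List EdgeStep) : Prop :=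
  ∀ (y : ε × Bool) (p p' q' q : ℕ) (k : 𝒢.K y.1),
    (p, (C.ne y.1, y.2), p') ∈ EL → (q', (C.ne y.1, !y.2), q) ∈ EL →
    C.Holds T (𝒢.tgt y) p' (𝒢.ω y k) q' →
    ∃ u : List (Fin (C.n (𝒢.src y))), (C.nv (𝒢.src y), p, u.map Fin.val, q) ∈ T ∧
      wordVal (C.gen _) u = 𝒢.α y k

/-- Over a closed set of items, a path whose label lies in a vertex group can be replaced by a
path without edges: Britton's lemma provides pinches, which are removed one at a time. -/
theorem Closed.exists_run (hT : C.Closed T EL) (h : C.PathRun T EL a p b q l) {g : 𝒢.G c}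
    (hg : 𝒢.evalG l = 𝒢.ofVertex c g) :
    ∃ m : List (Σ a, 𝒢.G a), C.PathRun T EL a p b q (m.map Sum.inl) ∧
      𝒢.evalG (m.map Sum.inl) = 𝒢.evalG l := by
  -- Each pinch that is removed lowers the number of edges in the label.
  induction hN : l.countP Sum.isRight using Nat.strong_induction_on generalizing l with
  | _ N ih =>
  obtain ⟨m, rfl⟩ | ⟨l₁, y, m, l₂, k, rfl, hk⟩ := 𝒢.britton h.isPathWord g hg
  · exact ⟨m, h, rfl⟩
  · obtain ⟨a₁, p₁, h1, h⟩ := h.split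
    cases h with
    | @edge _ _ _ p₂ _ _ hy h =>
    obtain ⟨a₂, q₂, h3, h⟩ := h.split
    obtain rfl := h3.eq_of_map_inl
    -- The generalizations make the indices of `h` variables, as case analysis requires.
    generalize hz : bar y = z at h
    generalize ha : 𝒢.tgt y = a' at h
    cases h with
    | @edge _ _ _ q₃ _ _ hy' h =>
    subst hz
    obtain ⟨u, hu, hu'⟩ := hT y p₁ p₂ q₂ q₃ k hy hy' ⟨m, h3.to_edges_nil, hk⟩
    have ht : 𝒢.tgt (bar y) = 𝒢.src y := by rw [tgt, bar_bar]
    rw [ht] at h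
    have e : 𝒢.evalG (l₁ ++ Sum.inl ⟨𝒢.src y, wordVal (C.gen _) u⟩ :: l₂) =
        𝒢.evalG (l₁ ++ Sum.inr y :: (m.map Sum.inl ++ Sum.inr (bar y) :: l₂)) := by
      simp only [evalG_append, evalG_inr_cons, evalG_inl_cons, hk, hu']
      rw [← ofEdge_mul_ofVertex_mul_bar]
      simp only [mul_assoc]
    obtain ⟨m', hm', e'⟩ := ih _ (by
      rw [← hN]
      simp only [List.countP_append, List.countP_cons, Sum.isRight_inl, Sum.isRight_inr]
      simp
      omega) (h1.append (.vert hu h))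
      (e.trans hg) rfl
    exact ⟨m', hm', e'.trans e⟩

theorem Closed.holds (hT : C.Closed T EL) (h : C.PathRun T EL a p a q l) {g : 𝒢.G a}
    (hg : 𝒢.evalG l = 𝒢.ofVertex a g) : C.Holds T a p g q := by
  obtain ⟨m, h1, h2⟩ := hT.exists_run h hg
  exact ⟨m, h1.to_edges_nil, h2.trans hg⟩

end Coding

end GraphOfGroups

namespace RatSub

/-! ### Raw instances and runs -/

/-- An automaton over an alphabet of natural numbers. -/
abbrev RawAutomaton : Type := ℕ × List ℕ × List (ℕ × List ℕ × ℕ)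

/-- An instance of the rational subset problem over an alphabet of natural numbers. -/
abbrev RawInstance : Type := RawAutomaton × List ℕ

/-- Forget the size of the alphabet. -/
def rawEdge {n : ℕ} (e : ℕ × List (Fin n) × ℕ) : ℕ × List ℕ × ℕ := (e.1, e.2.1.map Fin.val, e.2.2)

/-- Forget the size of the alphabet. -/
def rawInstance {n : ℕ} (I : Automaton n × List (Fin n)) : RawInstance :=
  ((I.1.1, I.1.2.1, I.1.2.2.map rawEdge), I.2.map Fin.val)

theorem encode_map_eq {α β : Type*} [Encodable α] [Encodable β] (f : α → β)
    (hf : ∀ x, Encodable.encode (f x) = Encodable.encode x) (l : List α) :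
    Encodable.encode (l.map f) = Encodable.encode l := by
  induction l with
  | nil => rfl
  | cons x l ih => simp [hf, ih]

/-- Instances and their raw forms have the same code, so programs cannot tell them apart. -/
theorem encode_rawInstance {n : ℕ} (I : Automaton n × List (Fin n)) :
    Encodable.encode (rawInstance I) = Encodable.encode I := by
  have h : ∀ l : List (Fin n), Encodable.encode (l.map Fin.val) = Encodable.encode l :=
    encode_map_eq _ fun _ => rfl
  obtain ⟨⟨p, ts, E⟩, w⟩ := I
  have hE : Encodable.encode (E.map rawEdge) = Encodable.encode E :=
    encode_map_eq rawEdge (fun e => by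
      obtain ⟨p, u, q⟩ := e
      simp only [rawEdge, Encodable.encode_prod_val, h]) E
  simp only [rawInstance, Encodable.encode_prod_val, h, hE]

theorem wordVal_nil {M : Type*} [Monoid M] {n : ℕ} (gen : Fin n → M) : wordVal gen [] = 1 := rfl

theorem wordVal_cons {M : Type*} [Monoid M] {n : ℕ} (gen : Fin n → M) (i : Fin n)
    (w : List (Fin n)) : wordVal gen (i :: w) = gen i * wordVal gen w := by
  simp [wordVal]

theorem wordVal_append {M : Type*} [Monoid M] {n : ℕ} (gen : Fin n → M) (w w' : List (Fin n)) :
    wordVal gen (w ++ w') = wordVal gen w * wordVal gen w' := by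
  simp [wordVal]

theorem Generates.exists_word {M : Type*} [Monoid M] {n : ℕ} {gen : Fin n → M}
    (h : Generates gen) (g : M) : ∃ w, wordVal gen w = g := by
  have hg : g ∈ Submonoid.closure (Set.range gen) := by rw [h]; trivial
  induction hg using Submonoid.closure_induction with
  | mem x hx =>
    obtain ⟨i, rfl⟩ := hx
    exact ⟨[i], by simp [wordVal]⟩
  | one => exact ⟨[], rfl⟩
  | mul x y _ _ hx hy =>
    obtain ⟨w, rfl⟩ := hx
    obtain ⟨w', rfl⟩ := hy
    exact ⟨w ++ w', wordVal_append gen w w'⟩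

end RatSub

namespace GraphOfGroups

open RatSub

/-! ### Saturation -/

/-- `S` can be built up from right to left so that each new element is the conclusion of a rule
`(conclusion, premise)` in `R` whose premise holds over the elements that are already there. -/
def Derivable {α : Type*} (R : List (α × α)) (H : List α → α → Prop) : List α → Prop
  | [] => True
  | c :: S => Derivable R H S ∧ ∃ x ∈ R, x.1 = c ∧ H S x.2

/-- Adding conclusions of rules terminates, since each conclusion is added at most once. -/
theorem exists_saturated {α : Type*} (R : List (α × α)) (H : List α → α → Prop) :
    ∃ S, Derivable R H S ∧ ∀ x ∈ R, x.1 ∈ S ∨ ¬ H S x.2 := by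
  classical
  suffices h : ∀ (N : ℕ) (S : List α), Derivable R H S →
      (R.countP fun x => x.1 ∉ S) = N →
      ∃ S, Derivable R H S ∧ ∀ x ∈ R, x.1 ∈ S ∨ ¬ H S x.2 from h _ [] trivial rfl
  intro N
  induction N using Nat.strong_induction_on with
  | _ N ih =>
  intro S hS hN
  by_cases h : ∀ x ∈ R, x.1 ∈ S ∨ ¬ H S x.2
  · exact ⟨S, hS, h⟩
  · push Not at h
    obtain ⟨x, hx, hxS, hH⟩ := h
    refine ih _ ?_ (x.1 :: S) ⟨hS, x, hx, rfl, hH⟩ rfl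
    rw [← hN]
    obtain ⟨R₁, R₂, rfl⟩ := List.append_of_mem hx
    have hle : ∀ R' : List (α × α), (R'.countP fun z => z.1 ∉ x.1 :: S) ≤
        R'.countP fun z => z.1 ∉ S := fun R' =>
      List.countP_mono_left fun z _ hz => by simp at hz ⊢; exact hz.2
    have h1 := hle R₁
    have h2 := hle R₂
    simp only [List.countP_append, List.countP_cons]
    simp [hxS] at h1 h2 ⊢
    omega

/-! ### The algorithm -/

/-- The state of the expanded automaton in which `rest` remains to be read before the state `q`
of the given automaton is reached. -/
def st (rest : List RawLetter) (q : ℕ) : ℕ := Encodable.encode (rest, q)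

theorem st_inj {U U' : List RawLetter} {q q' : ℕ} : st U q = st U' q' ↔ U = U' ∧ q = q' := by
  simp [st]

/-- The word over edges and generators of vertex groups obtained from a word over the generators
of the fundamental group. -/
def expand (ws : List (List RawLetter)) (u : List ℕ) : List RawLetter :=
  u.flatMap fun j => (ws[j]?).getD []

/-- The transitions by which a word is read, letter by letter, before the state `q`. -/
def steps (q : ℕ) : List RawLetter → List (ℕ × RawLetter × ℕ)
  | [] => []
  | x :: U => (st (x :: U) q, x, st U q) :: steps q U

/-- All transitions of the expanded automaton that are labelled by letters: the edges of the
automaton `A` are replaced by paths, and the word `W` is put in front of the initial state. -/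
def allSteps (d : RawDescription) (A : RawAutomaton) (W : List RawLetter) :
    List (ℕ × RawLetter × ℕ) :=
  steps A.1 W ++ A.2.2.flatMap fun e => steps e.2.2 (expand d.2.2.2 e.2.1)

/-- The transitions of the expanded automaton that are labelled by generators of the vertex groups,
and empty transitions, at the base vertex, from the states of `A` into the paths that replace its
edges. -/
def startItems (d : RawDescription) (A : RawAutomaton) (W : List RawLetter) : List Item :=
  ((allSteps d A W).flatMap fun s =>
    Sum.elim (fun i => [(i.1, s.1, [i.2], s.2.2)]) (fun _ => []) s.2.1) ++
  A.2.2.map fun e => (d.2.2.1, st [] e.1, [], st (expand d.2.2.2 e.2.1) e.2.2)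

/-- The transitions of the expanded automaton that are labelled by edges of the graph. -/
def edgeSteps (d : RawDescription) (A : RawAutomaton) (W : List RawLetter) : List EdgeStep :=
  (allSteps d A W).flatMap fun s =>
    Sum.elim (fun _ => []) (fun y => [(s.1, y, s.2.2)]) s.2.1

/-- The rules for the pair of transitions `s`, `s'`, labelled by inverse edges. The data `D` of the
edge list its end points and words in the order of the orientation `true`. -/
def pairRules (D : (ℕ × ℕ) × List (List ℕ × List ℕ)) (s s' : EdgeStep) : List (Item × Item) :=
  D.2.map fun q =>
    cond s.2.1.2 ((D.1.1, s.1, q.1, s'.2.2), (D.1.2, s.2.2, q.2, s'.1))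
      ((D.1.2, s.1, q.2, s'.2.2), (D.1.1, s.2.2, q.1, s'.1))

/-- The saturation rules `(conclusion, premise)`: if there are transitions `p →y p'` and
`q' →ȳ q`, and if `g ω_y` is the label of a path from `p'` to `q'`, then a
transition from `p` to `q` labelled by `g α_y` is added. -/
def rules (d : RawDescription) (EL : List EdgeStep) : List (Item × Item) :=
  EL.flatMap fun s => EL.flatMap fun s' =>
    if s.2.1.1 = s'.2.1.1 ∧ s'.2.1.2 = !s.2.1.2 then
      (d.2.1[s.2.1.1]?).toList.flatMap fun D => pairRules D s s' else []

/-- The transitions in `T` that belong to the vertex `a`. -/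
def edgesAt (a : ℕ) (T : List Item) : List (ℕ × List ℕ × ℕ) :=
  T.flatMap fun t => if t.1 = a then [t.2] else []

/-- Run the program for the vertex group at `a`, with fuel `f`, on the question whether the
element represented by `u` is the label of a path from `p` to `ts` with transitions in `T`. -/
def ask (f : ℕ) (cs : List Nat.Partrec.Code) (T : List Item) (a p : ℕ) (ts : List ℕ)
    (u : List ℕ) : Option ℕ :=
  (cs[a]?).bind fun c => c.evaln f (Encodable.encode (((p, ts, edgesAt a T), u) : RawInstance))

/-- The question of `ask` for the transition `t`. -/
def askItem (f : ℕ) (cs : List Nat.Partrec.Code) (T : List Item) (t : Item) : Option ℕ :=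
  ask f cs T t.1 t.2.1 [t.2.2.2] t.2.2.1

/-- A letter together with, if it is a generator of a vertex group, a word for its inverse. -/
abbrev InvLetter : Type := (ℕ × ℕ × List ℕ) ⊕ (ℕ × Bool)

/-- The letter of an `InvLetter`. -/
def InvLetter.letter (z : InvLetter) : RawLetter := Sum.map (fun t => (t.1, t.2.1)) id z

/-- The word for the inverse in an `InvLetter`. -/
def InvLetter.inv (z : InvLetter) : List RawLetter :=
  Sum.elim (fun t => t.2.2.map fun j => Sum.inl (t.1, j)) (fun y => [Sum.inr (y.1, !y.2)]) z

/-- The inverse word. -/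
def invWord (Z : List InvLetter) : List RawLetter := Z.foldr (fun z U => U ++ z.inv) []

/-- Correctness of the inverse in an `InvLetter`, according to the given programs: the automaton
with a single state and no edges recognises `{1}`. The letters of the inverse are required to be
in range, as nothing is known about the programs on other inputs. -/
def InvLetter.Ok (d : RawDescription) (cs : List Nat.Partrec.Code) (f : ℕ) (z : InvLetter) : Prop :=
  Sum.elim (fun t => (∀ j ∈ t.2.2, j < (d.1[t.1]?).getD 0) ∧
    ask f cs [] t.1 0 [0] (t.2.1 :: t.2.2) = some 1) (fun _ => True) z

/-- A certificate for the answer to an instance consists of an inverse of the given word, a list of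
transitions to be added, and fuel for the programs of the vertex groups. -/
abbrev Certificate : Type := List InvLetter × List Item × ℕ

/-- The certificate provides an inverse of the given word and a saturated list of
transitions. -/
def Certificate.Ok (d : RawDescription) (cs : List Nat.Partrec.Code) (I : RawInstance)
    (c : Certificate) : Prop :=
  (c.1.map InvLetter.letter = expand d.2.2.2 I.2 ∧ ∀ z ∈ c.1, InvLetter.Ok d cs c.2.2 z) ∧
  Derivable (rules d (edgeSteps d I.1 (invWord c.1)))
    (fun S t => askItem c.2.2 cs (S ++ startItems d I.1 (invWord c.1)) t = some 1) c.2.1 ∧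
  ∀ x ∈ rules d (edgeSteps d I.1 (invWord c.1)), x.1 ∈ c.2.1 ∨
    askItem c.2.2 cs (c.2.1 ++ startItems d I.1 (invWord c.1)) x.2 = some 0

/-- The answer obtained from a certificate. -/
def Certificate.answer (d : RawDescription) (cs : List Nat.Partrec.Code) (I : RawInstance)
    (c : Certificate) : Option ℕ :=
  ask c.2.2 cs (c.2.1 ++ startItems d I.1 (invWord c.1)) d.2.2.1 (st (invWord c.1) I.1.1)
    (I.1.2.1.map (st [])) []

/-! ### Correctness of the algorithm -/

variable {V : Type u} {ε : Type v} {𝒢 : GraphOfGroups.{u, v, w, x} V ε} {v₀ : V}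
  {d : RawDescription}

namespace Coding

variable (C : Coding 𝒢 v₀ d)

/-- The item is a transition of the vertex automaton at some vertex. -/
def ValidItem (t : Item) : Prop :=
  ∃ (a : V) (p : ℕ) (u : List (Fin (C.n a))) (q : ℕ), t = (C.nv a, p, u.map Fin.val, q)

/-- The transition `t` is redundant, given the transitions in `T` that belong to its vertex. -/
def HoldsItem (T : List Item) (t : Item) : Prop :=
  ∃ (a : V) (p : ℕ) (u : List (Fin (C.n a))) (q : ℕ), t = (C.nv a, p, u.map Fin.val, q) ∧
    C.Holds T a p (wordVal (C.gen a) u) q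

variable {C}

/-- Over valid transitions, the questions put to the programs are instances over the alphabet of the
vertex group. -/
theorem exists_edgesAt {T : List Item} (hT : ∀ t ∈ T, C.ValidItem t) (a : V) :
    ∃ E : List (ℕ × List (Fin (C.n a)) × ℕ), edgesAt (C.nv a) T = E.map rawEdge ∧
      ∀ p u q, (p, u, q) ∈ E ↔ (C.nv a, p, u.map Fin.val, q) ∈ T := by
  induction T with
  | nil => exact ⟨[], rfl, by simp⟩
  | cons t T ih =>
    obtain ⟨E, h1, h2⟩ := ih fun t ht => hT t (List.mem_cons_of_mem _ ht)
    obtain ⟨b, p, u, q, rfl⟩ := hT t List.mem_cons_self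
    by_cases hab : b = a
    · subst hab
      refine ⟨(p, u, q) :: E, ?_, fun p' u' q' => ?_⟩
      · rw [List.map_cons, ← h1]; simp [edgesAt, rawEdge]
      · simp [h2, map_val_injective.eq_iff]
    · refine ⟨E, ?_, fun p' u' q' => ?_⟩
      · rw [← h1]; simp [edgesAt, C.nv_injective.eq_iff, hab]
      · rw [h2]; simp [C.nv_injective.eq_iff, Ne.symm hab]

theorem holds_iff_run {T : List Item} {a : V} {E : List (ℕ × List (Fin (C.n a)) × ℕ)}
    (hE : ∀ p u q, (p, u, q) ∈ E ↔ (C.nv a, p, u.map Fin.val, q) ∈ T) (p q : ℕ) (g : 𝒢.G a) :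
    C.Holds T a p g q ↔ Run (C.gen a) E p q g := by
  constructor
  · rintro ⟨m, hm, e⟩
    induction m generalizing p g with
    | nil =>
      cases hm
      obtain rfl : g = 1 := 𝒢.ofVertex_injective a (by rw [map_one, ← e]; exact evalG_nil)
      exact .nil _
    | cons s m ih =>
      cases hm with
      | @vert _ _ _ q' _ u _ h hl =>
        rw [List.map_cons, evalG_inl_cons] at e
        have := ih q' ((wordVal (C.gen a) u)⁻¹ * g) hl (by rw [map_mul, ← e, map_inv]; simp)
        have h2 := Run.cons ((hE _ _ _).2 h) this
        rwa [mul_inv_cancel_left] at h2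
  · intro h
    induction h with
    | nil p => exact ⟨[], .nil _ _, by rw [map_one]; exact evalG_nil⟩
    | cons h hx ih =>
      obtain ⟨m, hm, e⟩ := ih
      exact ⟨⟨a, _⟩ :: m, .vert ((hE _ _ _).1 h) hm, by
        rw [List.map_cons, evalG_inl_cons, e, map_mul]⟩

/-- The programs in `cs` solve the rational subset problems of the vertex groups. -/
def Solves (C : Coding 𝒢 v₀ d) (cs : List Nat.Partrec.Code) : Prop :=
  ∀ a, ∃ c, cs[C.nv a]? = some c ∧ Decides c (C.gen a)

variable {cs : List Nat.Partrec.Code}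

theorem ask_spec (hcs : C.Solves cs) {T : List Item} (hT : ∀ t ∈ T, C.ValidItem t) (a : V) (p : ℕ)
    (ts : List ℕ) (u : List (Fin (C.n a))) :
    (∀ f r, ask f cs T (C.nv a) p ts (u.map Fin.val) = some r →
      r = 1 ∧ (∃ t ∈ ts, C.Holds T a p (wordVal (C.gen a) u) t) ∨
      r = 0 ∧ ¬ ∃ t ∈ ts, C.Holds T a p (wordVal (C.gen a) u) t) ∧
    ∃ f₀, ∀ f ≥ f₀,
      ((∃ t ∈ ts, C.Holds T a p (wordVal (C.gen a) u) t) →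
        ask f cs T (C.nv a) p ts (u.map Fin.val) = some 1) ∧
      ((¬ ∃ t ∈ ts, C.Holds T a p (wordVal (C.gen a) u) t) →
        ask f cs T (C.nv a) p ts (u.map Fin.val) = some 0) := by
  obtain ⟨c, hc, hd⟩ := hcs a
  obtain ⟨E, hE, hE'⟩ := exists_edgesAt hT a
  have hiff : (∃ t ∈ ts, C.Holds T a p (wordVal (C.gen a) u) t) ↔
      RationalMembership (C.gen a) ((p, ts, E), u) := by
    simp only [holds_iff_run hE']
    rfl
  have hask : ∀ f, ask f cs T (C.nv a) p ts (u.map Fin.val) =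
      c.evaln f (Encodable.encode (((p, ts, E), u) : Automaton (C.n a) × List (Fin (C.n a)))) := by
    intro f
    rw [← encode_rawInstance, ask, hc, hE]
    rfl
  rw [hiff]
  simp only [hask]
  obtain ⟨h1, h2⟩ := hd ((p, ts, E), u)
  have hs : ∀ {f r}, c.evaln f (Encodable.encode
      (((p, ts, E), u) : Automaton (C.n a) × List (Fin (C.n a)))) = some r →
      r ∈ c.eval (Encodable.encode (((p, ts, E), u) : Automaton (C.n a) × List (Fin (C.n a)))) :=
    fun h => Nat.Partrec.Code.evaln_sound h
  refine ⟨fun f r hf => ?_, ?_⟩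
  · have hr := hs hf
    by_cases hp : RationalMembership (C.gen a) ((p, ts, E), u)
    · rw [h1 hp, Part.mem_some_iff] at hr
      exact Or.inl ⟨hr, hp⟩
    · rw [h2 hp, Part.mem_some_iff] at hr
      exact Or.inr ⟨hr, hp⟩
  · by_cases hp : RationalMembership (C.gen a) ((p, ts, E), u)
    · have := h1 hp ▸ Part.mem_some 1
      obtain ⟨f₀, hf₀⟩ := Nat.Partrec.Code.evaln_complete.1 this
      exact ⟨f₀, fun f hf => ⟨fun _ => Nat.Partrec.Code.evaln_mono hf hf₀, fun h => absurd hp h⟩⟩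
    · have := h2 hp ▸ Part.mem_some 0
      obtain ⟨f₀, hf₀⟩ := Nat.Partrec.Code.evaln_complete.1 this
      exact ⟨f₀, fun f hf => ⟨fun h => absurd h hp, fun _ => Nat.Partrec.Code.evaln_mono hf hf₀⟩⟩

theorem holdsItem_iff {T : List Item} {a : V} {p : ℕ} {u : List (Fin (C.n a))} {q : ℕ} :
    C.HoldsItem T (C.nv a, p, u.map Fin.val, q) ↔ C.Holds T a p (wordVal (C.gen a) u) q := by
  constructor
  · rintro ⟨a', p', u', q', e, h⟩
    simp only [Prod.mk.injEq, C.nv_injective.eq_iff] at e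
    obtain ⟨rfl, rfl, e, rfl⟩ := e
    obtain rfl := map_val_injective e
    exact h
  · exact fun h => ⟨_, _, _, _, rfl, h⟩

theorem askItem_spec (hcs : C.Solves cs) {T : List Item} (hT : ∀ t ∈ T, C.ValidItem t) {t : Item}
    (ht : C.ValidItem t) :
    (∀ f r, askItem f cs T t = some r → r = 1 ∧ C.HoldsItem T t ∨ r = 0 ∧ ¬ C.HoldsItem T t) ∧
    ∃ f₀, ∀ f ≥ f₀, (C.HoldsItem T t → askItem f cs T t = some 1) ∧
      (¬ C.HoldsItem T t → askItem f cs T t = some 0) := by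
  obtain ⟨a, p, u, q, rfl⟩ := ht
  have := ask_spec hcs hT a p [q] u
  simp only [List.mem_singleton, exists_eq_left, ← holdsItem_iff] at this
  exact this

/-- The raw form of a word over edges and generators of vertex groups. -/
def rawLetter (C : Coding 𝒢 v₀ d) : (Σ a, Fin (C.n a)) ⊕ (ε × Bool) → RawLetter :=
  Sum.map (fun s => (C.nv s.1, (s.2 : ℕ))) (fun y => (C.ne y.1, y.2))

theorem expand_map_val (u : List (Fin C.r)) :
    expand d.2.2.2 (u.map Fin.val) = (u.flatMap C.piWord).map C.rawLetter := by
  induction u with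
  | nil => rfl
  | cons j u ih =>
    simp only [expand, List.map_cons, List.flatMap_cons, List.map_append] at ih ⊢
    rw [ih, C.word_eq j]
    rfl

theorem isPathWord_flatMap (u : List (Fin C.r)) : 𝒢.IsPathWord v₀ v₀ (u.flatMap C.piWord) := by
  induction u with
  | nil => rfl
  | cons j u ih => exact (C.piWord_cycle j).append 𝒢 ih

theorem eval_flatMap (u : List (Fin C.r)) :
    𝒢.eval C.gen (u.flatMap C.piWord) = ((wordVal C.piGen u : 𝒢.fundamentalGroup v₀) : 𝒢.F) := by
  induction u with
  | nil => exact eval_nil _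
  | cons j u ih =>
    rw [List.flatMap_cons, eval_append, ih, C.piWord_eval, wordVal_cons]
    rfl

/-! ### Inverse words -/

/-- A verified list of inverse letters spells an inverse of the given word, along the reversed
path. -/
theorem exists_inverse (hcs : C.Solves cs) {f : ℕ} {a b : V}
    {W : Words V ε (fun a => Fin (C.n a))} (hW : 𝒢.IsPathWord a b W) {Z : List InvLetter}
    (hZ : Z.map InvLetter.letter = W.map C.rawLetter) (hok : ∀ z ∈ Z, z.Ok d cs f) :
    ∃ W' : Words V ε (fun a => Fin (C.n a)), 𝒢.IsPathWord b a W' ∧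
      W'.map C.rawLetter = invWord Z ∧ 𝒢.eval C.gen W' = (𝒢.eval C.gen W)⁻¹ := by
  induction W generalizing a Z with
  | nil =>
    cases hW
    obtain rfl := List.map_eq_nil_iff.1 hZ
    exact ⟨[], rfl, rfl, by simp [eval]⟩
  | cons s W ih =>
    obtain _ | ⟨z, Z⟩ := Z
    · simp at hZ
    simp only [List.map_cons, List.cons.injEq] at hZ
    have hz := hok z List.mem_cons_self
    have hZok : ∀ z ∈ Z, z.Ok d cs f := fun z h => hok z (List.mem_cons_of_mem _ h)
    cases s with
    | inl s =>
      obtain ⟨c, i⟩ := s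
      obtain ⟨rfl, hW⟩ := hW
      obtain ⟨W', h1, h2, h3⟩ := ih hW hZ.2 hZok
      obtain ⟨c', i', w⟩ | y := z
      · have hl := hZ.1
        simp only [InvLetter.letter, rawLetter, Sum.map_inl, Sum.inl.injEq, Prod.mk.injEq] at hl
        obtain ⟨rfl, rfl⟩ := hl
        obtain ⟨hw, hask⟩ := hz
        simp only [C.n_eq, Option.getD_some] at hw
        obtain ⟨w, rfl⟩ : ∃ w' : List (Fin (C.n c)), w'.map Fin.val = w :=
          ⟨w.attach.map fun j => ⟨j.1, hw _ j.2⟩, by simp⟩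
        obtain ⟨-, t, -, m, hm, e⟩ | ⟨h, -⟩ :=
          (ask_spec hcs (T := []) (by simp) c 0 [0] (i :: w)).1 f 1 hask
        swap
        · exact absurd h one_ne_zero
        have hg : C.gen c i * wordVal (C.gen c) w = 1 := by
          cases m with
          | nil =>
            rw [← wordVal_cons]
            apply 𝒢.ofVertex_injective
            rw [← e, map_one]
            exact evalG_nil
          | cons s m => cases hm with | vert h => simp at h
        refine ⟨W' ++ w.map fun j => Sum.inl ⟨c, j⟩, h1.append 𝒢 ?_, ?_, ?_⟩
        · clear * -
          induction w with
          | nil => rfl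
          | cons j w ih => exact ⟨rfl, ih⟩
        · rw [List.map_append, h2]
          simp [invWord, InvLetter.inv, rawLetter, Function.comp_def]
        · rw [eval_append, h3, eval_inl_cons, mul_inv_rev]
          congr 1
          rw [← map_inv, inv_eq_of_mul_eq_one_right hg]
          clear * -
          induction w with
          | nil => simp [eval, wordVal]
          | cons j w ih => rw [List.map_cons, eval_inl_cons, ih, wordVal_cons, map_mul]
      · have hl := hZ.1
        simp [InvLetter.letter, rawLetter] at hl
    | inr y =>
      obtain ⟨rfl, hW⟩ := hW
      obtain ⟨W', h1, h2, h3⟩ := ih hW hZ.2 hZok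
      obtain z | y' := z
      · have hl := hZ.1
        simp [InvLetter.letter, rawLetter] at hl
      · have hl := hZ.1
        simp only [InvLetter.letter, rawLetter, Sum.map_inr, Sum.inr.injEq, id] at hl
        subst hl
        refine ⟨W' ++ [Sum.inr (bar y)], h1.append 𝒢 ⟨rfl, ?_⟩, ?_, ?_⟩
        · rw [tgt, bar_bar]; rfl
        · rw [List.map_append, h2]; rfl
        · rw [eval_append, h3, eval_inr_cons, eval_inr_cons, eval_nil, mul_inv_rev, mul_one,
            eq_inv_of_mul_eq_one_right (𝒢.ofEdge_mul_bar y)]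

theorem exists_invLetters (hcs : C.Solves cs) (W : Words V ε (fun a => Fin (C.n a))) :
    ∃ Z : List InvLetter, Z.map InvLetter.letter = W.map C.rawLetter ∧
      ∃ f₀, ∀ f ≥ f₀, ∀ z ∈ Z, z.Ok d cs f := by
  induction W with
  | nil => exact ⟨[], rfl, 0, by simp⟩
  | cons s W ih =>
    obtain ⟨Z, hZ, f₀, hf₀⟩ := ih
    obtain ⟨a, i⟩ | y := s
    · obtain ⟨w, hw⟩ := (C.gen_generates a).exists_word (C.gen a i)⁻¹
      obtain ⟨-, f₁, hf₁⟩ := ask_spec hcs (T := []) (by simp) a 0 [0] (i :: w)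
      refine ⟨Sum.inl (C.nv a, i, w.map Fin.val) :: Z, ?_, max f₀ f₁, fun f hf z hz => ?_⟩
      · rw [List.map_cons, hZ]; rfl
      · rw [List.mem_cons] at hz
        obtain rfl | hz := hz
        · refine ⟨?_, (hf₁ f (le_of_max_le_right hf)).1 ⟨0, by simp, [], .nil _ _, ?_⟩⟩
          · simp [C.n_eq]
          · rw [wordVal_cons, hw, mul_inv_cancel, map_one]; exact evalG_nil
        · exact hf₀ f (le_of_max_le_left hf) z hz
    · refine ⟨Sum.inr (C.ne y.1, y.2) :: Z, ?_, f₀, fun f hf z hz => ?_⟩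
      · rw [List.map_cons, hZ]; rfl
      · rw [List.mem_cons] at hz
        obtain rfl | hz := hz
        · trivial
        · exact hf₀ f hf z hz

end Coding

end GraphOfGroups

namespace GraphOfGroups

open RatSub

variable {V : Type u} {ε : Type v} {𝒢 : GraphOfGroups.{u, v, w, x} V ε} {v₀ : V}
  {d : RawDescription}

namespace Coding

variable {C : Coding 𝒢 v₀ d}

/-! ### The expanded automaton -/

theorem rawLetter_injective : Function.Injective C.rawLetter := by
  refine Function.Injective.sumMap ?_ ?_
  · rintro ⟨a, i⟩ ⟨b, j⟩ h
    simp only [Prod.mk.injEq] at h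
    obtain ⟨h1, h2⟩ := h
    obtain rfl := C.nv_injective h1
    obtain rfl := Fin.ext h2
    rfl
  · rintro ⟨e, b⟩ ⟨e', b'⟩ h
    simp only [Prod.mk.injEq] at h
    obtain ⟨h1, rfl⟩ := h
    obtain rfl := C.ne_injective h1
    rfl

theorem exists_of_mem_steps {W : Words V ε (fun a => Fin (C.n a))} {q : ℕ}
    {s : ℕ × RawLetter × ℕ} (h : s ∈ steps q (W.map C.rawLetter)) :
    ∃ (z : (Σ a, Fin (C.n a)) ⊕ (ε × Bool)) (U : Words V ε (fun a => Fin (C.n a))),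
      s = (st (C.rawLetter z :: U.map C.rawLetter) q, C.rawLetter z, st (U.map C.rawLetter) q) := by
  induction W with
  | nil => simp [steps] at h
  | cons z W ih =>
    rw [List.map_cons, steps, List.mem_cons] at h
    obtain rfl | h := h
    · exact ⟨z, W, rfl⟩
    · exact ih h

theorem exists_of_mem_allSteps {A : Automaton C.r} {W : Words V ε (fun a => Fin (C.n a))}
    {w : List (Fin C.r)} {s : ℕ × RawLetter × ℕ}
    (h : s ∈ allSteps d (rawInstance (A, w)).1 (W.map C.rawLetter)) :
    ∃ (z : (Σ a, Fin (C.n a)) ⊕ (ε × Bool)) (U : Words V ε (fun a => Fin (C.n a))) (q : ℕ),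
      s = (st (C.rawLetter z :: U.map C.rawLetter) q, C.rawLetter z, st (U.map C.rawLetter) q) := by
  rw [allSteps, List.mem_append, List.mem_flatMap] at h
  obtain h | ⟨e, he, h⟩ := h
  · obtain ⟨z, U, h⟩ := exists_of_mem_steps h
    exact ⟨z, U, _, h⟩
  · obtain ⟨e, -, rfl⟩ := List.mem_map.1 he
    simp only [rawEdge] at h
    rw [expand_map_val] at h
    obtain ⟨z, U, h⟩ := exists_of_mem_steps h
    exact ⟨z, U, _, h⟩

theorem mem_startItems {A : Automaton C.r} {w : List (Fin C.r)} {U : List RawLetter} {t : Item} :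
    t ∈ startItems d (rawInstance (A, w)).1 U ↔
      (∃ p a i q, (p, Sum.inl (a, i), q) ∈ allSteps d (rawInstance (A, w)).1 U ∧
        t = (a, p, [i], q)) ∨
      ∃ p u q, (p, u, q) ∈ A.2.2 ∧
        t = (C.nv v₀, st [] p, [], st ((u.flatMap C.piWord).map C.rawLetter) q) := by
  rw [startItems, List.mem_append]
  refine or_congr ?_ ?_
  · rw [List.mem_flatMap]
    constructor
    · rintro ⟨⟨p, ⟨a, i⟩ | y, q⟩, h, ht⟩
      · exact ⟨p, a, i, q, h, by simpa using ht⟩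
      · simp at ht
    · rintro ⟨p, a, i, q, h, rfl⟩
      exact ⟨_, h, by simp⟩
  · simp only [rawInstance, List.map_map, List.mem_map, Function.comp_apply, rawEdge, C.base_eq,
      expand_map_val, Prod.exists]
    simp only [eq_comm]

theorem mem_edgeSteps {A : RawAutomaton} {U : List RawLetter} {p q : ℕ} {y : ℕ × Bool} :
    (p, y, q) ∈ edgeSteps d A U ↔ (p, Sum.inr y, q) ∈ allSteps d A U := by
  rw [edgeSteps, List.mem_flatMap]
  constructor
  · rintro ⟨⟨p, i | y, q⟩, h, ht⟩
    · simp at ht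
    · simp only [Sum.elim_inr, List.mem_singleton, Prod.mk.injEq] at ht
      obtain ⟨rfl, rfl, rfl⟩ := ht
      exact h
  · intro h
    exact ⟨_, h, by simp⟩

theorem validItem_of_mem_startItems {A : Automaton C.r} {w : List (Fin C.r)}
    {W : Words V ε (fun a => Fin (C.n a))} {t : Item}
    (h : t ∈ startItems d (rawInstance (A, w)).1 (W.map C.rawLetter)) : C.ValidItem t := by
  obtain ⟨p, a, i, q, h', rfl⟩ | ⟨p, u, q, -, rfl⟩ := mem_startItems.1 h
  · obtain ⟨z, U, q', h⟩ := exists_of_mem_allSteps h'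
    obtain ⟨b, j⟩ | y := z
    · simp only [rawLetter, Sum.map_inl, Prod.mk.injEq, Sum.inl.injEq] at h
      obtain ⟨-, ⟨rfl, rfl⟩, -⟩ := h
      exact ⟨b, p, [j], q, rfl⟩
    · simp [rawLetter] at h
  · exact ⟨v₀, _, [], _, rfl⟩

theorem exists_edge_of_mem_edgeSteps {A : Automaton C.r} {w : List (Fin C.r)}
    {W : Words V ε (fun a => Fin (C.n a))} {p q : ℕ} {z : ℕ × Bool}
    (h : (p, z, q) ∈ edgeSteps d (rawInstance (A, w)).1 (W.map C.rawLetter)) :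
    ∃ y : ε × Bool, z = (C.ne y.1, y.2) := by
  obtain ⟨z', U, q', h⟩ := exists_of_mem_allSteps (mem_edgeSteps.1 h)
  obtain s | y := z'
  · simp [rawLetter] at h
  · simp only [rawLetter, Sum.map_inr, Prod.mk.injEq, Sum.inr.injEq] at h
    exact ⟨y, h.2.1⟩

section Runs

variable {A : Automaton C.r} {w : List (Fin C.r)} {W : Words V ε (fun a => Fin (C.n a))}

/-- Words that are spelled by transitions of the expanded automaton label paths in it. -/
theorem exists_run_of_steps {U : Words V ε (fun a => Fin (C.n a))} {a b : V} {q : ℕ}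
    (hU : 𝒢.IsPathWord a b U)
    (h : ∀ s ∈ steps q (U.map C.rawLetter),
      s ∈ allSteps d (rawInstance (A, w)).1 (W.map C.rawLetter)) :
    ∃ l, C.PathRun (startItems d (rawInstance (A, w)).1 (W.map C.rawLetter))
      (edgeSteps d (rawInstance (A, w)).1 (W.map C.rawLetter)) a (st (U.map C.rawLetter) q)
        b (st [] q) l ∧ 𝒢.evalG l = 𝒢.eval C.gen U := by
  induction U generalizing a with
  | nil =>
    cases hU
    exact ⟨[], .nil _ _, rfl⟩
  | cons s U ih =>
    simp only [List.map_cons, steps, List.mem_cons, forall_eq_or_imp] at h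
    cases s with
    | inl s =>
      obtain ⟨c, i⟩ := s
      obtain ⟨rfl, hU⟩ := hU
      obtain ⟨l, hl, e⟩ := ih hU h.2
      refine ⟨_, .vert (u := [i]) (mem_startItems.2 (Or.inl ⟨_, _, _, _, h.1, rfl⟩)) hl, ?_⟩
      rw [evalG_inl_cons, eval_inl_cons, e]
      simp [wordVal]
    | inr y =>
      obtain ⟨rfl, hU⟩ := hU
      obtain ⟨l, hl, e⟩ := ih hU h.2
      refine ⟨_, .edge (mem_edgeSteps.2 h.1) hl, ?_⟩
      rw [evalG_inr_cons, eval_inr_cons, e]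

theorem exists_pathRun_of_run {p q : ℕ} {x : 𝒢.fundamentalGroup v₀}
    (h : Run C.piGen A.2.2 p q x) :
    ∃ l, C.PathRun (startItems d (rawInstance (A, w)).1 (W.map C.rawLetter))
      (edgeSteps d (rawInstance (A, w)).1 (W.map C.rawLetter)) v₀ (st [] p)
        v₀ (st [] q) l ∧ 𝒢.evalG l = x := by
  induction h with
  | nil p => exact ⟨[], .nil _ _, by rw [evalG_nil]; rfl⟩
  | @cons p q s u x h hx ih =>
    obtain ⟨l, hl, e⟩ := ih
    have hsteps : ∀ s ∈ steps q ((u.flatMap C.piWord).map C.rawLetter),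
        s ∈ allSteps d (rawInstance (A, w)).1 (W.map C.rawLetter) := by
      intro s hs
      rw [allSteps, List.mem_append, List.mem_flatMap]
      refine Or.inr ⟨rawEdge (p, u, q), List.mem_map_of_mem h, ?_⟩
      simp only [rawEdge]
      rwa [expand_map_val]
    obtain ⟨l', hl', e'⟩ := exists_run_of_steps (isPathWord_flatMap u) hsteps
    refine ⟨_, .vert (u := []) (mem_startItems.2 (Or.inr ⟨p, u, q, h, rfl⟩)) (hl'.append hl), ?_⟩
    rw [evalG_inl_cons, evalG_append, e, e', eval_flatMap, wordVal_nil, map_one, one_mul]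
    rfl

/-- A path in the expanded automaton which starts in the middle of a word `U` and ends in a state
of the given automaton finishes reading `U` and continues as a path of the given automaton. -/
theorem exists_run_of_pathRun {a b : V} {σ q t : ℕ} {l : Words V ε 𝒢.G}
    (h : C.PathRun (startItems d (rawInstance (A, w)).1 (W.map C.rawLetter))
      (edgeSteps d (rawInstance (A, w)).1 (W.map C.rawLetter)) a σ b t l)
    {U : Words V ε (fun a => Fin (C.n a))} (hσ : σ = st (U.map C.rawLetter) q) {t' : ℕ}
    (ht : t = st [] t') :
    ∃ x, Run C.piGen A.2.2 q t' x ∧ 𝒢.evalG l = 𝒢.eval C.gen U * x := by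
  induction h generalizing U q with
  | nil a p =>
    subst hσ
    rw [st_inj, List.map_eq_nil_iff] at ht
    obtain ⟨rfl, rfl⟩ := ht
    exact ⟨1, .nil _, by simp [eval]⟩
  | @vert a b p p' s u l h hl ih =>
    obtain ⟨p₁, a₁, i, q₁, h, e⟩ | ⟨p₁, u₁, q₁, h', e⟩ := mem_startItems.1 h
    · simp only [Prod.mk.injEq] at e
      obtain ⟨ha, rfl, hu, rfl⟩ := e
      obtain ⟨z, U', q', h⟩ := exists_of_mem_allSteps h
      obtain ⟨b, j⟩ | y := z
      · simp only [Prod.mk.injEq] at h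
        obtain ⟨h1, h2, h3⟩ := h
        simp only [rawLetter, Sum.map_inl, Sum.inl.injEq, Prod.mk.injEq] at h2
        obtain ⟨h2, rfl⟩ := h2
        obtain rfl : a = b := C.nv_injective (ha.trans h2)
        obtain rfl : u = [j] := map_val_injective hu
        obtain ⟨x, hx, e⟩ := ih h3 ht
        rw [h1, ← List.map_cons, st_inj, (List.map_injective_iff.2 rawLetter_injective).eq_iff]
          at hσ
        obtain ⟨rfl, rfl⟩ := hσ
        refine ⟨x, hx, ?_⟩
        rw [evalG_inl_cons, eval_inl_cons, e, wordVal_cons, wordVal_nil, mul_one, mul_assoc]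
      · simp [rawLetter] at h
    · simp only [Prod.mk.injEq, C.nv_injective.eq_iff] at e
      obtain ⟨rfl, rfl, hu, rfl⟩ := e
      obtain rfl := List.map_eq_nil_iff.1 hu
      rw [← List.map_nil (f := C.rawLetter), st_inj,
        (List.map_injective_iff.2 rawLetter_injective).eq_iff] at hσ
      obtain ⟨rfl, rfl⟩ := hσ
      obtain ⟨x, hx, e⟩ := ih rfl ht
      refine ⟨_, .cons h' hx, ?_⟩
      rw [evalG_inl_cons, e, eval_flatMap, wordVal_nil, map_one, one_mul, eval_nil, one_mul]
      rfl
  | @edge y b p p' s l h hl ih =>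
    obtain ⟨z, U', q', h⟩ := exists_of_mem_allSteps (mem_edgeSteps.1 h)
    obtain z | y' := z
    · simp [rawLetter] at h
    · simp only [Prod.mk.injEq] at h
      obtain ⟨h1, h2, h3⟩ := h
      obtain rfl : y = y' := Sum.inr_injective (rawLetter_injective (C := C) h2)
      obtain ⟨x, hx, e⟩ := ih h3 ht
      rw [h1, ← List.map_cons, st_inj, (List.map_injective_iff.2 rawLetter_injective).eq_iff]
        at hσ
      obtain ⟨rfl, rfl⟩ := hσ
      exact ⟨x, hx, by rw [evalG_inr_cons, eval_inr_cons, e, mul_assoc]⟩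

/-- If `W` represents the inverse of `w`, accepting paths of the expanded automaton with label `1`
correspond to accepting paths of the given automaton with label `w`. -/
theorem exists_pathRun_iff (hW : 𝒢.IsPathWord v₀ v₀ W)
    (hWw : 𝒢.eval C.gen W = ((wordVal C.piGen w : 𝒢.fundamentalGroup v₀) : 𝒢.F)⁻¹) (t : ℕ) :
    (∃ l, C.PathRun (startItems d (rawInstance (A, w)).1 (W.map C.rawLetter))
      (edgeSteps d (rawInstance (A, w)).1 (W.map C.rawLetter)) v₀ (st (W.map C.rawLetter) A.1)
        v₀ (st [] t) l ∧ 𝒢.evalG l = 1) ↔ Run C.piGen A.2.2 A.1 t (wordVal C.piGen w) := by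
  constructor
  · rintro ⟨l, hl, e⟩
    obtain ⟨x, hx, e'⟩ := exists_run_of_pathRun hl rfl rfl
    rw [e, hWw, eq_comm, inv_mul_eq_one] at e'
    rwa [Subtype.ext e']
  · intro h
    obtain ⟨l, hl, e⟩ := exists_pathRun_of_run (W := W) (w := w) h
    obtain ⟨l', hl', e'⟩ := exists_run_of_steps (A := A) (w := w) (W := W) (q := A.1) hW
      fun s hs => List.mem_append_left _ hs
    exact ⟨_, hl'.append hl, by rw [evalG_append, e, e', hWw, inv_mul_cancel]⟩

end Runs

/-! ### The saturation rules -/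

section Rules

variable {EL : List EdgeStep}

theorem exists_of_mem_rules (hEL : ∀ s ∈ EL, ∃ y : ε × Bool, s.2.1 = (C.ne y.1, y.2))
    {x : Item × Item} (hx : x ∈ rules d EL) :
    ∃ (y : ε × Bool) (k : 𝒢.K y.1) (u : List (Fin (C.n (𝒢.src y))))
      (u' : List (Fin (C.n (𝒢.tgt y)))) (p p' q' q : ℕ),
      (p, (C.ne y.1, y.2), p') ∈ EL ∧ (q', (C.ne y.1, !y.2), q) ∈ EL ∧
      wordVal (C.gen _) u = 𝒢.α y k ∧ wordVal (C.gen _) u' = 𝒢.ω y k ∧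
      x = ((C.nv (𝒢.src y), p, u.map Fin.val, q), (C.nv (𝒢.tgt y), p', u'.map Fin.val, q')) := by
  rw [rules, List.mem_flatMap] at hx
  obtain ⟨⟨p, z, p'⟩, hs, hx⟩ := hx
  rw [List.mem_flatMap] at hx
  obtain ⟨⟨q', z', q⟩, hs', hx⟩ := hx
  obtain ⟨⟨e, b⟩, hy⟩ := hEL _ hs
  simp only at hy
  subst hy
  split_ifs at hx with hz
  · obtain ⟨h1, h2⟩ := hz
    obtain ⟨e', b'⟩ := z'
    simp only at h1 h2
    subst h1 h2
    simp only [C.edge_eq, Option.toList_some, List.flatMap_cons, List.flatMap_nil,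
      List.append_nil, pairRules, List.map_map, List.mem_map, Function.comp_apply] at hx
    obtain ⟨q₁, hq₁, rfl⟩ := hx
    have hk : (wordVal (C.gen _) q₁.1, wordVal (C.gen _) q₁.2) ∈
        {p | ∃ q ∈ C.edgeWords e, p = (wordVal (C.gen _) q.1, wordVal (C.gen _) q.2)} :=
      ⟨q₁, hq₁, rfl⟩
    rw [C.edgeWords_spec e] at hk
    obtain ⟨k, hk⟩ := hk
    simp only [Prod.mk.injEq] at hk
    cases b
    · exact ⟨(e, false), k, q₁.2, q₁.1, p, p', q', q, hs, hs', hk.2.symm, hk.1.symm, rfl⟩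
    · exact ⟨(e, true), k, q₁.1, q₁.2, p, p', q', q, hs, hs', hk.1.symm, hk.2.symm, rfl⟩
  · simp at hx

theorem exists_mem_rules {y : ε × Bool} {p p' q' q : ℕ} (k : 𝒢.K y.1)
    (h1 : (p, (C.ne y.1, y.2), p') ∈ EL) (h2 : (q', (C.ne y.1, !y.2), q) ∈ EL) :
    ∃ (u : List (Fin (C.n (𝒢.src y)))) (u' : List (Fin (C.n (𝒢.tgt y)))),
      wordVal (C.gen _) u = 𝒢.α y k ∧ wordVal (C.gen _) u' = 𝒢.ω y k ∧
      ((C.nv (𝒢.src y), p, u.map Fin.val, q), (C.nv (𝒢.tgt y), p', u'.map Fin.val, q')) ∈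
        rules d EL := by
  obtain ⟨e, b⟩ := y
  have hk : (𝒢.α (e, true) k, 𝒢.α (e, false) k) ∈
      Set.range fun g : 𝒢.K e => (𝒢.α (e, true) g, 𝒢.α (e, false) g) := ⟨k, rfl⟩
  rw [← C.edgeWords_spec e] at hk
  obtain ⟨q₁, hq₁, hk⟩ := hk
  simp only [Prod.mk.injEq] at hk
  have key : ∀ x, x = cond b
      (((C.nv (𝒢.src (e, true)), p, q₁.1.map Fin.val, q),
        (C.nv (𝒢.src (e, false)), p', q₁.2.map Fin.val, q')) : Item × Item)
      ((C.nv (𝒢.src (e, false)), p, q₁.2.map Fin.val, q),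
        (C.nv (𝒢.src (e, true)), p', q₁.1.map Fin.val, q')) → x ∈ rules d EL := by
    rintro x rfl
    rw [rules, List.mem_flatMap]
    refine ⟨_, h1, ?_⟩
    rw [List.mem_flatMap]
    refine ⟨_, h2, ?_⟩
    rw [if_pos ⟨rfl, rfl⟩]
    simp only [C.edge_eq, Option.toList_some, List.flatMap_cons, List.flatMap_nil,
      List.append_nil, pairRules, List.map_map, List.mem_map, Function.comp_apply]
    exact ⟨q₁, hq₁, rfl⟩
  cases b
  · exact ⟨q₁.2, q₁.1, hk.2.symm, hk.1.symm, key _ rfl⟩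
  · exact ⟨q₁.1, q₁.2, hk.1.symm, hk.2.symm, key _ rfl⟩

theorem validItem_of_mem_rules (hEL : ∀ s ∈ EL, ∃ y : ε × Bool, s.2.1 = (C.ne y.1, y.2))
    {x : Item × Item} (hx : x ∈ rules d EL) : C.ValidItem x.1 ∧ C.ValidItem x.2 := by
  obtain ⟨y, k, u, u', p, p', q', q, -, -, -, -, rfl⟩ := exists_of_mem_rules hEL hx
  exact ⟨⟨_, _, _, _, rfl⟩, ⟨_, _, _, _, rfl⟩⟩

theorem closed_of_rules {T : List Item} (h : ∀ x ∈ rules d EL, x.1 ∈ T ∨ ¬ C.HoldsItem T x.2) :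
    C.Closed T EL := by
  intro y p p' q' q k h1 h2 hk
  obtain ⟨u, u', hu, hu', hx⟩ := exists_mem_rules k h1 h2
  refine ⟨u, (h _ hx).resolve_right fun hn => hn ?_, hu⟩
  rw [holdsItem_iff, hu']
  exact hk

/-- Derived transitions are realised by paths: each rule application corresponds to a pinch whose
middle part is realised by induction. -/
theorem sound_of_derivable (hEL : ∀ s ∈ EL, ∃ y : ε × Bool, s.2.1 = (C.ne y.1, y.2))
    {T S : List Item} (hS : Derivable (rules d EL) (fun S t => C.HoldsItem (S ++ T) t) S) :
    ∀ t ∈ S ++ T, C.Sound T EL t := by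
  induction S with
  | nil => exact fun t ht => sound_of_mem ht
  | cons c S ih =>
    obtain ⟨hS, x, hx, rfl, hH⟩ := hS
    intro t ht
    rw [List.cons_append, List.mem_cons] at ht
    obtain rfl | ht := ht
    · obtain ⟨y, k, u, u', p, p', q', q, h1, h2, hu, hu', rfl⟩ := exists_of_mem_rules hEL hx
      simp only at hH
      rw [holdsItem_iff, hu'] at hH
      rintro a p₁ v q₁ e
      simp only [Prod.mk.injEq, C.nv_injective.eq_iff] at e
      obtain ⟨rfl, rfl, e, rfl⟩ := e
      obtain rfl := map_val_injective e
      rw [hu]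
      exact exists_pinch_run (ih hS) h1 h2 hH
    · exact ih hS t ht

end Rules

/-! ### Correctness of certificates -/

section Certificates

variable {cs : List Nat.Partrec.Code} {A : Automaton C.r} {w : List (Fin C.r)}
  {EL : List EdgeStep} {T : List Item}

theorem Derivable.validItem {H : List Item → Item → Prop}
    (hEL : ∀ s ∈ EL, ∃ y : ε × Bool, s.2.1 = (C.ne y.1, y.2)) (hT : ∀ t ∈ T, C.ValidItem t)
    {S : List Item} (hS : Derivable (rules d EL) H S) : ∀ t ∈ S ++ T, C.ValidItem t := by
  induction S with
  | nil => exact hT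
  | cons c S ih =>
    obtain ⟨hS, x, hx, rfl, -⟩ := hS
    intro t ht
    rw [List.cons_append, List.mem_cons] at ht
    obtain rfl | ht := ht
    · exact (validItem_of_mem_rules hEL hx).1
    · exact ih hS t ht

theorem derivable_of_ask (hcs : C.Solves cs)
    (hEL : ∀ s ∈ EL, ∃ y : ε × Bool, s.2.1 = (C.ne y.1, y.2)) (hT : ∀ t ∈ T, C.ValidItem t)
    {f : ℕ} {S : List Item}
    (hS : Derivable (rules d EL) (fun S t => askItem f cs (S ++ T) t = some 1) S) :
    Derivable (rules d EL) (fun S t => C.HoldsItem (S ++ T) t) S := by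
  induction S with
  | nil => trivial
  | cons c S ih =>
    obtain ⟨hS, x, hx, rfl, h⟩ := hS
    refine ⟨ih hS, x, hx, rfl, ?_⟩
    obtain ⟨-, h⟩ | ⟨h, -⟩ := (askItem_spec hcs (Derivable.validItem hEL hT hS)
      (validItem_of_mem_rules hEL hx).2).1 f 1 h
    · exact h
    · exact absurd h one_ne_zero

theorem ask_of_derivable (hcs : C.Solves cs)
    (hEL : ∀ s ∈ EL, ∃ y : ε × Bool, s.2.1 = (C.ne y.1, y.2)) (hT : ∀ t ∈ T, C.ValidItem t)
    {S : List Item} (hS : Derivable (rules d EL) (fun S t => C.HoldsItem (S ++ T) t) S) :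
    ∃ f₀, ∀ f ≥ f₀, Derivable (rules d EL) (fun S t => askItem f cs (S ++ T) t = some 1) S := by
  induction S with
  | nil => exact ⟨0, fun _ _ => trivial⟩
  | cons c S ih =>
    obtain ⟨hS, x, hx, rfl, h⟩ := hS
    obtain ⟨f₀, hf₀⟩ := ih hS
    obtain ⟨-, f₁, hf₁⟩ := askItem_spec hcs (Derivable.validItem hEL hT hS)
      (validItem_of_mem_rules hEL hx).2
    exact ⟨max f₀ f₁, fun f hf => ⟨hf₀ f (le_of_max_le_left hf), x, hx, rfl,
      (hf₁ f (le_of_max_le_right hf)).1 h⟩⟩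

theorem ask_of_closed (hcs : C.Solves cs)
    (hEL : ∀ s ∈ EL, ∃ y : ε × Bool, s.2.1 = (C.ne y.1, y.2)) {S : List Item}
    (hT : ∀ t ∈ S ++ T, C.ValidItem t)
    (hS : ∀ x ∈ rules d EL, x.1 ∈ S ∨ ¬ C.HoldsItem (S ++ T) x.2) :
    ∃ f₀, ∀ f ≥ f₀, ∀ x ∈ rules d EL, x.1 ∈ S ∨ askItem f cs (S ++ T) x.2 = some 0 := by
  have hR : ∀ x ∈ rules d EL, C.ValidItem x.2 := fun x hx => (validItem_of_mem_rules hEL hx).2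
  generalize rules d EL = R at hS hR
  induction R with
  | nil => exact ⟨0, by simp⟩
  | cons x R ih =>
    rw [List.forall_mem_cons] at hS hR
    obtain ⟨f₀, hf₀⟩ := ih hS.2 hR.2
    obtain ⟨-, f₁, hf₁⟩ := askItem_spec hcs hT hR.1
    exact ⟨max f₀ f₁, fun f hf => List.forall_mem_cons.2
      ⟨hS.1.imp_right (hf₁ f (le_of_max_le_right hf)).2, hf₀ f (le_of_max_le_left hf)⟩⟩

/-- Over saturated transitions, the rational subset problem of the vertex group at the base
vertex answers the given instance. -/
theorem exists_holds_iff {W : Words V ε (fun a => Fin (C.n a))} (hW : 𝒢.IsPathWord v₀ v₀ W)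
    (hWw : 𝒢.eval C.gen W = ((wordVal C.piGen w : 𝒢.fundamentalGroup v₀) : 𝒢.F)⁻¹)
    {S : List Item}
    (hS : Derivable (rules d (edgeSteps d (rawInstance (A, w)).1 (W.map C.rawLetter)))
      (fun S t => C.HoldsItem (S ++ startItems d (rawInstance (A, w)).1 (W.map C.rawLetter)) t) S)
    (hS' : ∀ x ∈ rules d (edgeSteps d (rawInstance (A, w)).1 (W.map C.rawLetter)), x.1 ∈ S ∨
      ¬ C.HoldsItem (S ++ startItems d (rawInstance (A, w)).1 (W.map C.rawLetter)) x.2) :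
    (∃ t ∈ A.2.1.map (st []),
      C.Holds (S ++ startItems d (rawInstance (A, w)).1 (W.map C.rawLetter)) v₀
        (st (W.map C.rawLetter) A.1) 1 t) ↔ RationalMembership C.piGen (A, w) := by
  have hEL : ∀ s ∈ edgeSteps d (rawInstance (A, w)).1 (W.map C.rawLetter),
      ∃ y : ε × Bool, s.2.1 = (C.ne y.1, y.2) := fun s hs => exists_edge_of_mem_edgeSteps hs
  have hC := closed_of_rules fun x hx => (hS' x hx).imp_left (List.mem_append_left _)
  simp only [List.mem_map, exists_exists_and_eq_and]
  refine exists_congr fun t => and_congr_right fun _ => ?_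
  rw [← exists_pathRun_iff hW hWw]
  constructor
  · rintro ⟨m, hm, e⟩
    obtain ⟨l, hl, e'⟩ := hm.of_edges_nil.exists_of_sound (sound_of_derivable hEL hS)
    exact ⟨l, hl, by rw [e', e, map_one]⟩
  · rintro ⟨l, hl, e⟩
    exact hC.holds (hl.mono (List.subset_append_right _ _)) (by rw [e, map_one])

/-- The answer of a correct certificate is right. Derivability of the added transitions gives
soundness of a positive answer, and closedness gives soundness of a negative one. -/
theorem answer_sound (hcs : C.Solves cs) {c : Certificate} (hc : c.Ok d cs (rawInstance (A, w)))
    {r : ℕ} (hr : c.answer d cs (rawInstance (A, w)) = some r) :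
    r = 1 ∧ RationalMembership C.piGen (A, w) ∨ r = 0 ∧ ¬ RationalMembership C.piGen (A, w) := by
  obtain ⟨Z, S, f⟩ := c
  obtain ⟨⟨hZ, hZ'⟩, hS, hS'⟩ := hc
  have hZ2 : Z.map InvLetter.letter = (w.flatMap C.piWord).map C.rawLetter :=
    hZ.trans (expand_map_val w)
  obtain ⟨W, hW, hWZ, hWe⟩ := exists_inverse hcs (isPathWord_flatMap w) hZ2 hZ'
  rw [eval_flatMap] at hWe
  simp only [← hWZ] at hS hS'
  have hEL : ∀ s ∈ edgeSteps d (rawInstance (A, w)).1 (W.map C.rawLetter),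
      ∃ y : ε × Bool, s.2.1 = (C.ne y.1, y.2) := fun s hs => exists_edge_of_mem_edgeSteps hs
  have hT := fun t ht => validItem_of_mem_startItems (C := C) (A := A) (w := w) (W := W) (t := t) ht
  have hST := Derivable.validItem hEL hT hS
  have hiff := exists_holds_iff hW hWe (derivable_of_ask hcs hEL hT hS) fun x hx =>
    (hS' x hx).imp_right fun h0 => by
      obtain ⟨h, -⟩ | ⟨-, h⟩ :=
        (askItem_spec hcs hST (validItem_of_mem_rules hEL hx).2).1 f 0 h0
      · exact absurd h zero_ne_one
      · exact h
  have hask := ask_spec hcs hST v₀ (st (W.map C.rawLetter) A.1) (A.2.1.map (st [])) []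
  rw [wordVal_nil, hiff] at hask
  simp only [Certificate.answer, ← hWZ, C.base_eq] at hr
  exact hask.1 f r hr

/-- A correct certificate with an answer is obtained from an inverse word and a saturated list of
transitions; finitely many questions are asked, so some amount of fuel suffices for all. -/
theorem exists_answer (hcs : C.Solves cs) (A : Automaton C.r) (w : List (Fin C.r)) :
    ∃ c : Certificate, c.Ok d cs (rawInstance (A, w)) ∧
      (c.answer d cs (rawInstance (A, w)) = some 1 ∨
        c.answer d cs (rawInstance (A, w)) = some 0) := by
  obtain ⟨Z, hZ, f₀, hf₀⟩ := exists_invLetters hcs (w.flatMap C.piWord)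
  obtain ⟨W, hW, hWZ, hWe⟩ := exists_inverse hcs (isPathWord_flatMap w) hZ (hf₀ f₀ le_rfl)
  rw [eval_flatMap] at hWe
  have hEL : ∀ s ∈ edgeSteps d (rawInstance (A, w)).1 (W.map C.rawLetter),
      ∃ y : ε × Bool, s.2.1 = (C.ne y.1, y.2) := fun s hs => exists_edge_of_mem_edgeSteps hs
  have hT := fun t ht => validItem_of_mem_startItems (C := C) (A := A) (w := w) (W := W) (t := t) ht
  obtain ⟨S, hS, hS'⟩ := exists_saturated
    (rules d (edgeSteps d (rawInstance (A, w)).1 (W.map C.rawLetter)))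
    (fun S t => C.HoldsItem (S ++ startItems d (rawInstance (A, w)).1 (W.map C.rawLetter)) t)
  have hST := Derivable.validItem hEL hT hS
  obtain ⟨f₁, hf₁⟩ := ask_of_derivable hcs hEL hT hS
  obtain ⟨f₂, hf₂⟩ := ask_of_closed hcs hEL hST hS'
  obtain ⟨-, f₃, hf₃⟩ :=
    ask_spec hcs hST v₀ (st (W.map C.rawLetter) A.1) (A.2.1.map (st [])) []
  have h0 : f₀ ≤ f₀ + f₁ + f₂ + f₃ := by omega
  have h1 : f₁ ≤ f₀ + f₁ + f₂ + f₃ := by omega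
  have h2 : f₂ ≤ f₀ + f₁ + f₂ + f₃ := by omega
  have h3 : f₃ ≤ f₀ + f₁ + f₂ + f₃ := by omega
  refine ⟨(Z, S, f₀ + f₁ + f₂ + f₃), ⟨⟨hZ.trans (expand_map_val w).symm, hf₀ _ h0⟩, ?_, ?_⟩, ?_⟩
  · simp only [← hWZ]
    exact hf₁ _ h1
  · simp only [← hWZ]
    exact hf₂ _ h2
  · simp only [Certificate.answer, ← hWZ, C.base_eq]
    by_cases h : ∃ t ∈ A.2.1.map (st []),
        C.Holds (S ++ startItems d (rawInstance (A, w)).1 (W.map C.rawLetter)) v₀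
          (st (W.map C.rawLetter) A.1) (wordVal (C.gen v₀) []) t
    · exact Or.inl ((hf₃ _ h3).1 h)
    · exact Or.inr ((hf₃ _ h3).2 h)

end Certificates

end Coding

end GraphOfGroups

namespace GraphOfGroups

open RatSub

/-! ### Computability of the algorithm -/

section Primrec

open Primrec

variable {α β γ σ : Type*} [Primcodable α] [Primcodable β] [Primcodable γ] [Primcodable σ]

theorem primrecPred_forall_mem {l : α → List β} {P : α → β → Prop} (hl : Primrec l)
    (hP : PrimrecRel P) : PrimrecPred fun a => ∀ b ∈ l a, P a b :=
  (PrimrecRel.forall_mem_list hP.swap).comp hl .id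

theorem primrecPred_exists_mem {l : α → List β} {P : α → β → Prop} (hl : Primrec l)
    (hP : PrimrecRel P) : PrimrecPred fun a => ∃ b ∈ l a, P a b :=
  (PrimrecRel.exists_mem_list hP.swap).comp hl .id

theorem primrec_sum_elim {f : α → β ⊕ γ} {g : α → β → σ} {h : α → γ → σ} (hf : Primrec f)
    (hg : Primrec₂ g) (hh : Primrec₂ h) : Primrec fun a => Sum.elim (g a) (h a) (f a) :=
  (sumCasesOn hf hg hh).of_eq fun a => by cases f a <;> rfl

theorem primrecPred_mem {l : α → List β} {f : α → β} (hl : Primrec l) (hf : Primrec f) :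
    PrimrecPred fun a => f a ∈ l a :=
  (primrecPred_exists_mem (P := fun a b => b = f a) hl
    (Primrec.eq.comp snd (hf.comp fst))).of_eq fun a => by simp

theorem primrec_singleton {f : α → β} (hf : Primrec f) : Primrec fun a => [f a] :=
  list_cons.comp hf (const [])

theorem primrec_st : Primrec₂ st := Primrec.encode.comp (fst.pair snd)

theorem primrec_expand : Primrec₂ expand :=
  list_flatMap (f := fun a : List (List RawLetter) × List ℕ => a.2)
    (g := fun a j => (a.1[j]?).getD []) snd
    (option_getD.comp₂ (list_getElem?.comp₂ (fst.comp fst) snd) (const []))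

theorem primrec_steps : Primrec₂ steps := by
  have h : Primrec fun a : ℕ × List RawLetter =>
      (List.recOn a.2 [] fun x U IH => (st (x :: U) a.1, x, st U a.1) :: IH :
        List (ℕ × RawLetter × ℕ)) :=
    list_rec (f := fun a : ℕ × List RawLetter => a.2) (g := fun _ => [])
      (h := fun a b => (st (b.1 :: b.2.1) a.1, b.1, st b.2.1 a.1) :: b.2.2) snd (const [])
      (list_cons.comp
        ((primrec_st.comp (list_cons.comp (fst.comp snd) (fst.comp (snd.comp snd)))
          (fst.comp fst)).pair ((fst.comp snd).pair
            (primrec_st.comp (fst.comp (snd.comp snd)) (fst.comp fst))))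
        (snd.comp (snd.comp snd)))
  refine h.of_eq fun a => ?_
  obtain ⟨q, U⟩ := a
  induction U with
  | nil => rfl
  | cons x U ih => exact congrArg (_ :: ·) ih

/-- The input from which the expanded automaton is computed: the description, the given
automaton and the inverse of the given word. -/
abbrev Input : Type := RawDescription × RawAutomaton × List RawLetter

theorem primrec_allSteps : Primrec fun a : Input => allSteps a.1 a.2.1 a.2.2 :=
  list_append.comp (primrec_steps.comp (fst.comp (fst.comp snd)) (snd.comp snd))
    (list_flatMap (f := fun a : Input => a.2.1.2.2)
      (g := fun a e => steps e.2.2 (expand a.1.2.2.2 e.2.1))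
      (snd.comp (snd.comp (fst.comp snd)))
      (primrec_steps.comp (snd.comp (snd.comp snd))
        (primrec_expand.comp (snd.comp (snd.comp (snd.comp (fst.comp fst))))
          (fst.comp (snd.comp snd)))))

theorem primrec_startItems : Primrec fun a : Input => startItems a.1 a.2.1 a.2.2 := by
  refine list_append.comp (list_flatMap primrec_allSteps ?_) (list_map ?_ ?_)
  · refine primrec_sum_elim (fst.comp (snd.comp snd)) ?_ (const [])
    exact primrec_singleton ((fst.comp snd).pair ((fst.comp (snd.comp fst)).pair
      ((primrec_singleton (snd.comp snd)).pair (snd.comp (snd.comp (snd.comp fst))))))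
  · exact snd.comp (snd.comp (fst.comp snd))
  · exact (fst.comp (snd.comp (snd.comp (fst.comp fst)))).pair
      ((primrec_st.comp (const []) (fst.comp snd)).pair ((const []).pair
        (primrec_st.comp (primrec_expand.comp
          (snd.comp (snd.comp (snd.comp (fst.comp fst)))) (fst.comp (snd.comp snd)))
          (snd.comp (snd.comp snd)))))

theorem primrec_edgeSteps : Primrec fun a : Input => edgeSteps a.1 a.2.1 a.2.2 := by
  refine list_flatMap primrec_allSteps ?_
  refine primrec_sum_elim (fst.comp (snd.comp snd)) (const []) ?_
  exact primrec_singleton ((fst.comp (snd.comp fst)).pair (snd.pair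
    (snd.comp (snd.comp (snd.comp fst)))))

theorem primrec_pairRules : Primrec fun a : ((ℕ × ℕ) × List (List ℕ × List ℕ)) × EdgeStep ×
    EdgeStep => pairRules a.1 a.2.1 a.2.2 := by
  refine list_map (snd.comp fst) ?_
  have hp : Primrec fun b : (((ℕ × ℕ) × List (List ℕ × List ℕ)) × EdgeStep × EdgeStep) ×
    (List ℕ × List ℕ) => b.1.2.1.1 := fst.comp (fst.comp (snd.comp fst))
  have hp' : Primrec fun b : (((ℕ × ℕ) × List (List ℕ × List ℕ)) × EdgeStep × EdgeStep) ×
    (List ℕ × List ℕ) => b.1.2.1.2.2 := snd.comp (snd.comp (fst.comp (snd.comp fst)))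
  have hq' : Primrec fun b : (((ℕ × ℕ) × List (List ℕ × List ℕ)) × EdgeStep × EdgeStep) ×
    (List ℕ × List ℕ) => b.1.2.2.1 := fst.comp (snd.comp (snd.comp fst))
  have hq : Primrec fun b : (((ℕ × ℕ) × List (List ℕ × List ℕ)) × EdgeStep × EdgeStep) ×
    (List ℕ × List ℕ) => b.1.2.2.2.2 := snd.comp (snd.comp (snd.comp (snd.comp fst)))
  have h1 : Primrec fun b : (((ℕ × ℕ) × List (List ℕ × List ℕ)) × EdgeStep × EdgeStep) ×
    (List ℕ × List ℕ) => b.1.1.1.1 := fst.comp (fst.comp (fst.comp fst))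
  have h2 : Primrec fun b : (((ℕ × ℕ) × List (List ℕ × List ℕ)) × EdgeStep × EdgeStep) ×
    (List ℕ × List ℕ) => b.1.1.1.2 := snd.comp (fst.comp (fst.comp fst))
  exact Primrec.cond (snd.comp (fst.comp (snd.comp (fst.comp (snd.comp fst)))))
    ((h1.pair (hp.pair ((fst.comp snd).pair hq))).pair
      (h2.pair (hp'.pair ((snd.comp snd).pair hq'))))
    ((h2.pair (hp.pair ((snd.comp snd).pair hq))).pair
      (h1.pair (hp'.pair ((fst.comp snd).pair hq'))))

theorem primrecPred_bar : PrimrecPred fun b : EdgeStep × EdgeStep =>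
    b.1.2.1.1 = b.2.2.1.1 ∧ b.2.2.1.2 = !b.1.2.1.2 := by
  have h1 : Primrec fun b : EdgeStep × EdgeStep => b.1.2.1 := fst.comp (snd.comp fst)
  have h2 : Primrec fun b : EdgeStep × EdgeStep => b.2.2.1 := fst.comp (snd.comp snd)
  exact (Primrec.eq.comp (fst.comp h1) (fst.comp h2)).and
    (Primrec.eq.comp (snd.comp h2) (Primrec.not.comp (snd.comp h1)))

theorem primrec_rules : Primrec₂ rules := by
  have h1 : Primrec fun b : ((RawDescription × List EdgeStep) × EdgeStep) × EdgeStep =>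
      (b.1.2, b.2) := (snd.comp fst).pair snd
  have h2 : Primrec fun b : ((RawDescription × List EdgeStep) × EdgeStep) × EdgeStep =>
      b.1.1.1.2.1 := fst.comp (snd.comp (fst.comp (fst.comp fst)))
  have h3 : Primrec fun b : ((RawDescription × List EdgeStep) × EdgeStep) × EdgeStep =>
      b.1.2.2.1.1 := fst.comp (fst.comp (snd.comp (snd.comp fst)))
  have h5 : Primrec fun c : (((RawDescription × List EdgeStep) × EdgeStep) × EdgeStep) ×
      ((ℕ × ℕ) × List (List ℕ × List ℕ)) => (c.2, c.1.1.2, c.1.2) :=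
    snd.pair ((snd.comp (fst.comp fst)).pair (snd.comp fst))
  have h6 : Primrec₂ fun (b : ((RawDescription × List EdgeStep) × EdgeStep) × EdgeStep)
      (D : (ℕ × ℕ) × List (List ℕ × List ℕ)) => pairRules D b.1.2 b.2 :=
    -- Elaborated without the expected type: unification against it would unfold `pairRules`.
    (primrec_pairRules.comp h5 :)
  have h4 : Primrec fun b : ((RawDescription × List EdgeStep) × EdgeStep) × EdgeStep =>
      (b.1.1.1.2.1[b.1.2.2.1.1]?).toList.flatMap fun D => pairRules D b.1.2 b.2 :=
    list_flatMap (optionToList.comp (list_getElem?.comp h2 h3))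
      h6
  exact list_flatMap snd (list_flatMap (snd.comp fst)
    (Primrec.ite (primrecPred_bar.comp h1) h4 (const [])))

theorem primrec_edgesAt : Primrec₂ edgesAt := by
  refine list_flatMap snd ?_
  exact Primrec.ite (Primrec.eq.comp (fst.comp snd) (fst.comp fst))
    (primrec_singleton (snd.comp snd)) (const [])

theorem primrec_ask : Primrec fun a : (ℕ × List Nat.Partrec.Code) × List Item × ℕ × ℕ × List ℕ ×
    List ℕ => ask a.1.1 a.1.2 a.2.1 a.2.2.1 a.2.2.2.1 a.2.2.2.2.1 a.2.2.2.2.2 := by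
  refine option_bind (list_getElem?.comp (snd.comp fst) (fst.comp (snd.comp snd))) ?_
  have hI : Primrec fun a : (ℕ × List Nat.Partrec.Code) × List Item × ℕ × ℕ × List ℕ × List ℕ =>
      (((a.2.2.2.1, a.2.2.2.2.1, edgesAt a.2.2.1 a.2.1), a.2.2.2.2.2) : RawInstance) :=
    ((fst.comp (snd.comp (snd.comp snd))).pair ((fst.comp (snd.comp (snd.comp
      (snd.comp snd)))).pair (primrec_edgesAt.comp (fst.comp (snd.comp snd))
        (fst.comp snd)))).pair (snd.comp (snd.comp (snd.comp (snd.comp snd))))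
  exact Nat.Partrec.Code.primrec_evaln.comp
    (((fst.comp (fst.comp fst)).pair snd).pair (Primrec.encode.comp (hI.comp fst)))

theorem primrec_askItem : Primrec fun a : (ℕ × List Nat.Partrec.Code) × List Item × Item =>
    askItem a.1.1 a.1.2 a.2.1 a.2.2 :=
  primrec_ask.comp (fst.pair ((fst.comp snd).pair ((fst.comp (snd.comp snd)).pair
    ((fst.comp (snd.comp (snd.comp snd))).pair
      ((primrec_singleton (snd.comp (snd.comp (snd.comp (snd.comp snd))))).pair
        (fst.comp (snd.comp (snd.comp (snd.comp snd)))))))))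

theorem primrec_letter : Primrec InvLetter.letter :=
  (primrec_sum_elim (f := fun z : InvLetter => z)
    (g := fun _ t => (Sum.inl (t.1, t.2.1) : RawLetter)) (h := fun _ y => Sum.inr y) Primrec.id
    (sumInl.comp ((fst.comp snd).pair (fst.comp (snd.comp snd)))) (sumInr.comp snd)).of_eq
    fun z => by cases z <;> rfl

theorem primrec_inv : Primrec InvLetter.inv :=
  primrec_sum_elim (f := fun z : InvLetter => z) Primrec.id
    (list_map (snd.comp (snd.comp snd)) (sumInl.comp ((fst.comp (snd.comp fst)).pair snd)))
    (primrec_singleton (sumInr.comp ((fst.comp snd).pair (Primrec.not.comp (snd.comp snd)))))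

theorem primrec_invWord : Primrec invWord :=
  list_foldr (f := fun Z : List InvLetter => Z) (g := fun _ => [])
    (h := fun _ b => b.2 ++ b.1.inv) Primrec.id (const [])
    (list_append.comp (snd.comp snd) (primrec_inv.comp (fst.comp snd)))

/-- The input of the check of a certificate. -/
abbrev CheckInput : Type :=
  (RawDescription × List Nat.Partrec.Code) × RawInstance × Certificate

/-- The check of an entry of `InvLetter` that stands for a generator of a vertex group. -/
theorem primrecPred_inv_ok_aux : PrimrecPred fun b :
      (List ℕ × List Nat.Partrec.Code × ℕ) × (ℕ × ℕ × List ℕ) =>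
    (∀ j ∈ b.2.2.2, j < (b.1.1[b.2.1]?).getD 0) ∧
      ask b.1.2.2 b.1.2.1 [] b.2.1 0 [0] (b.2.2.1 :: b.2.2.2) = some 1 := by
  refine PrimrecPred.and ?_ ?_
  · have h : Primrec fun b : (List ℕ × List Nat.Partrec.Code × ℕ) × (ℕ × ℕ × List ℕ) =>
        (b.1.1[b.2.1]?).getD 0 :=
      option_getD.comp (list_getElem?.comp (fst.comp fst) (fst.comp snd)) (const 0)
    exact primrecPred_forall_mem (snd.comp (snd.comp snd)) (nat_lt.comp snd (h.comp fst))
  · have h : Primrec fun b : (List ℕ × List Nat.Partrec.Code × ℕ) × (ℕ × ℕ × List ℕ) =>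
        (((b.1.2.2, b.1.2.1), ([], b.2.1, 0, [0], b.2.2.1 :: b.2.2.2)) :
          (ℕ × List Nat.Partrec.Code) × List Item × ℕ × ℕ × List ℕ × List ℕ) :=
      ((snd.comp (snd.comp fst)).pair (fst.comp (snd.comp fst))).pair ((const []).pair
        ((fst.comp snd).pair ((const 0).pair ((const [0]).pair
          (list_cons.comp (fst.comp (snd.comp snd)) (snd.comp (snd.comp snd)))))))
    exact Primrec.eq.comp (primrec_ask.comp h) (const (some 1))

theorem primrecPred_inv_ok : PrimrecPred fun a : CheckInput × InvLetter =>
    InvLetter.Ok a.1.1.1 a.1.1.2 a.1.2.2.2.2 a.2 := by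
  classical
  have h : Primrec fun a : (CheckInput × InvLetter) × (ℕ × ℕ × List ℕ) =>
      ((a.1.1.1.1.1, a.1.1.1.2, a.1.1.2.2.2.2), a.2) :=
    ((fst.comp (fst.comp (fst.comp (fst.comp fst)))).pair
      ((snd.comp (fst.comp (fst.comp fst))).pair
        (snd.comp (snd.comp (snd.comp (snd.comp (fst.comp fst))))))).pair snd
  have h' := (primrecPred_inv_ok_aux.comp h).decide
  have h'' := primrec_sum_elim (f := fun a : CheckInput × InvLetter => a.2)
    (g := fun a t => decide ((∀ j ∈ t.2.2, j < (a.1.1.1.1[t.1]?).getD 0) ∧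
      ask a.1.2.2.2.2 a.1.1.2 [] t.1 0 [0] (t.2.1 :: t.2.2) = some 1)) snd h'
    (Primrec.const true).to₂
  refine PrimrecPred.of_eq (Primrec.eq.comp h'' (const true)) fun a => ?_
  obtain ⟨a, t | y⟩ := a
  · simp [InvLetter.Ok]
  · simp [InvLetter.Ok]

theorem primrec_startItems_check : Primrec fun a : CheckInput =>
    startItems a.1.1 a.2.1.1 (invWord a.2.2.1) :=
  primrec_startItems.comp ((fst.comp fst).pair ((fst.comp (fst.comp snd)).pair
    (primrec_invWord.comp (fst.comp (snd.comp snd)))))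

theorem primrec_rules_check : Primrec fun a : CheckInput =>
    rules a.1.1 (edgeSteps a.1.1 a.2.1.1 (invWord a.2.2.1)) :=
  primrec_rules.comp (fst.comp fst) (primrec_edgeSteps.comp ((fst.comp fst).pair
    ((fst.comp (fst.comp snd)).pair (primrec_invWord.comp (fst.comp (snd.comp snd))))))

theorem primrec_askItem_check : Primrec fun a : CheckInput × List Item × Item =>
    askItem a.1.2.2.2.2 a.1.1.2 (a.2.1 ++ startItems a.1.1.1 a.1.2.1.1 (invWord a.1.2.2.1))
      a.2.2 :=
  primrec_askItem.comp (((snd.comp (snd.comp (snd.comp (snd.comp fst)))).pair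
    (snd.comp (fst.comp fst))).pair ((list_append.comp (fst.comp snd)
      (primrec_startItems_check.comp fst)).pair (snd.comp snd)))

theorem primrecPred_derivable {β : Type*} [Primcodable β] {R : α → List (β × β)}
    {H : α → List β → β → Prop} {S : α → List β} (hR : Primrec R)
    (hH : PrimrecPred fun a : α × List β × β => H a.1 a.2.1 a.2.2) (hS : Primrec S) :
    PrimrecPred fun a => Derivable (R a) (H a) (S a) := by
  classical
  have hstep : PrimrecPred fun b : α × β × List β × Bool =>
      ∃ x ∈ R b.1, x.1 = b.2.1 ∧ H b.1 b.2.2.1 x.2 := by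
    refine primrecPred_exists_mem (hR.comp fst) (PrimrecPred.and ?_ ?_)
    · exact Primrec.eq.comp (fst.comp snd) (fst.comp (snd.comp fst))
    · exact hH.comp ((fst.comp fst).pair ((fst.comp (snd.comp (snd.comp fst))).pair
        (snd.comp snd)))
  have hrec := list_rec (f := S) (g := fun _ => true)
    (h := fun a b => b.2.2 && decide (∃ x ∈ R a, x.1 = b.1 ∧ H a b.2.1 x.2)) hS (const true)
    (Primrec.and.comp (snd.comp (snd.comp snd)) hstep.decide)
  refine PrimrecPred.of_eq (Primrec.eq.comp hrec (const true)) fun a => ?_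
  induction S a with
  | nil => simp [Derivable]
  | cons c S ih => simp only [Derivable, Bool.and_eq_true, decide_eq_true_eq, ← ih]

theorem primrecPred_certificate_ok : PrimrecPred fun a : CheckInput =>
    a.2.2.Ok a.1.1 a.1.2 a.2.1 := by
  refine PrimrecPred.and (PrimrecPred.and ?_ ?_) (PrimrecPred.and ?_ ?_)
  · exact Primrec.eq.comp
      (list_map (fst.comp (snd.comp snd)) (primrec_letter.comp snd))
      (primrec_expand.comp (snd.comp (snd.comp (snd.comp (fst.comp fst))))
        (snd.comp (fst.comp snd)))
  · exact primrecPred_forall_mem (fst.comp (snd.comp snd)) primrecPred_inv_ok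
  · exact primrecPred_derivable primrec_rules_check
      (Primrec.eq.comp primrec_askItem_check (const (some 1)))
      (fst.comp (snd.comp (snd.comp snd)))
  · refine primrecPred_forall_mem primrec_rules_check (PrimrecPred.or ?_ ?_)
    · exact primrecPred_mem (fst.comp (snd.comp (snd.comp (snd.comp fst)))) (fst.comp snd)
    · have h : Primrec fun b : CheckInput × (Item × Item) => (b.1, b.1.2.2.2.1, b.2.2) :=
        fst.pair ((fst.comp (snd.comp (snd.comp (snd.comp fst)))).pair (snd.comp snd))
      exact Primrec.eq.comp (primrec_askItem_check.comp h) (const (some 0))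

theorem primrec_answer : Primrec fun a : CheckInput => a.2.2.answer a.1.1 a.1.2 a.2.1 := by
  have h1 : Primrec fun a : CheckInput => (a.2.2.2.2, a.1.2) :=
    (snd.comp (snd.comp (snd.comp snd))).pair (snd.comp fst)
  have h2 : Primrec fun a : CheckInput =>
      a.2.2.2.1 ++ startItems a.1.1 a.2.1.1 (invWord a.2.2.1) :=
    list_append.comp (fst.comp (snd.comp (snd.comp snd))) primrec_startItems_check
  have h3 : Primrec fun a : CheckInput => a.1.1.2.2.1 :=
    fst.comp (snd.comp (snd.comp (fst.comp fst)))
  have h4 : Primrec fun a : CheckInput => st (invWord a.2.2.1) a.2.1.1.1 :=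
    primrec_st.comp (primrec_invWord.comp (fst.comp (snd.comp snd)))
      (fst.comp (fst.comp (fst.comp snd)))
  have h5 : Primrec₂ fun (_ : CheckInput) (q : ℕ) => st [] q := primrec_st.comp (const []) snd
  have h6 : Primrec fun a : CheckInput => a.2.1.1.2.1.map (st []) :=
    list_map (fst.comp (snd.comp (fst.comp (fst.comp snd)))) h5
  exact (primrec_ask.comp (h1.pair (h2.pair (h3.pair (h4.pair (h6.pair (const [])))))) :)

end Primrec

open Classical in
/-- The answer of a certificate, if the certificate is correct. -/
noncomputable def checkedAnswer (a : CheckInput) : Option ℕ :=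
  if a.2.2.Ok a.1.1 a.1.2 a.2.1 then a.2.2.answer a.1.1 a.1.2 a.2.1 else none

theorem primrec_checkedAnswer : Primrec checkedAnswer := by
  classical
  exact Primrec.ite primrecPred_certificate_ok primrec_answer (Primrec.const none)

/-- The answer of the `n`-th certificate, if it is a correct certificate. -/
noncomputable def certAnswer (a : (RawDescription × List Nat.Partrec.Code) × RawInstance) (n : ℕ) :
    Option ℕ :=
  (Encodable.decode (α := Certificate) n).bind fun c => checkedAnswer (a.1, a.2, c)

theorem computable_certAnswer : Computable₂ certAnswer := by
  have h : Primrec fun b : (((RawDescription × List Nat.Partrec.Code) × RawInstance) × ℕ) ×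
      Certificate => ((b.1.1.1, b.1.1.2, b.2) : CheckInput) :=
    (Primrec.fst.comp (Primrec.fst.comp Primrec.fst)).pair
      ((Primrec.snd.comp (Primrec.fst.comp Primrec.fst)).pair Primrec.snd)
  have h' : Primrec₂ fun (b : ((RawDescription × List Nat.Partrec.Code) × RawInstance) × ℕ)
      (c : Certificate) => checkedAnswer (b.1.1, b.1.2, c) := (primrec_checkedAnswer.comp h :)
  exact (Primrec.option_bind (Primrec.decode.comp Primrec.snd) h').to_comp

/-- Every partial computable function of two variables is computed by programs for the
functions of the second variable, which are computable from the first (the s-m-n theorem). -/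
theorem exists_program {α β : Type*} [Primcodable α] [Primcodable β] {g : α → β →. ℕ}
    (hg : Partrec₂ g) : ∃ Φ : α → Nat.Partrec.Code, Computable Φ ∧
      ∀ a b, (Φ a).eval (Encodable.encode b) = g a b := by
  obtain ⟨c, hc⟩ := Nat.Partrec.Code.exists_code.1 hg
  refine ⟨fun a => c.curry (Encodable.encode a),
    (Nat.Partrec.Code.primrec₂_curry.comp (Primrec.const c) Primrec.encode).to_comp,
    fun a b => ?_⟩
  rw [Nat.Partrec.Code.eval_curry, hc]
  beta_reduce
  have : Encodable.decode (α := α × β) (Nat.pair (Encodable.encode a) (Encodable.encode b)) =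
      some (a, b) := by
    exact Encodable.encodek (a, b)
  rw [this]
  simp only [Part.coe_some, Part.bind_some]
  exact Part.map_id' (fun _ => rfl) _

/-- One algorithm solves the rational subset problem of all fundamental groups of graphs of groups,
given descriptions and programs for the vertex groups: it searches for a certificate. -/
theorem exists_uniform_program : ∃ Φ : RawDescription × List Nat.Partrec.Code → Nat.Partrec.Code,
    Computable Φ ∧ ∀ {V : Type u} {ε : Type v} {𝒢 : GraphOfGroups.{u, v, w, x} V ε} {v₀ : V}
      {d : RawDescription} (C : Coding 𝒢 v₀ d) (cs : List Nat.Partrec.Code), C.Solves cs →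
        Decides (Φ (d, cs)) C.piGen := by
  obtain ⟨Φ, hΦ, h⟩ := exists_program (g := fun a I => Nat.rfindOpt (certAnswer (a, I)))
    (Partrec.rfindOpt computable_certAnswer)
  refine ⟨Φ, hΦ, fun {V ε 𝒢 v₀ d} C cs hcs I => ?_⟩
  obtain ⟨A, w⟩ := I
  rw [← encode_rawInstance, h]
  have hsound : ∀ n r, r ∈ certAnswer ((d, cs), rawInstance (A, w)) n → ∃ c : Certificate,
      c.Ok d cs (rawInstance (A, w)) ∧ c.answer d cs (rawInstance (A, w)) = some r := by
    intro n r hr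
    obtain ⟨c, -, hc⟩ := Option.bind_eq_some_iff.1 hr
    rw [checkedAnswer] at hc
    split_ifs at hc with hok
    exact ⟨c, hok, hc⟩
  have hex : ∃ r, r ∈ Nat.rfindOpt (certAnswer ((d, cs), rawInstance (A, w))) := by
    rw [← Part.dom_iff_mem, Nat.rfindOpt_dom]
    obtain ⟨c, hok, hc⟩ := Coding.exists_answer hcs A w
    have hn : certAnswer ((d, cs), rawInstance (A, w)) (Encodable.encode c) =
        c.answer d cs (rawInstance (A, w)) := by
      rw [certAnswer, Encodable.encodek, Option.bind_some, checkedAnswer, if_pos hok]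
    obtain hc | hc := hc
    · exact ⟨_, 1, by rw [hn, hc]; rfl⟩
    · exact ⟨_, 0, by rw [hn, hc]; rfl⟩
  obtain ⟨r, hr⟩ := hex
  obtain ⟨n, hn⟩ := Nat.rfindOpt_spec hr
  obtain ⟨c, hok, hc⟩ := hsound n r hn
  rw [Part.eq_some_iff.2 hr]
  obtain ⟨rfl, h⟩ | ⟨rfl, h⟩ := Coding.answer_sound hcs hok hc
  · exact ⟨fun _ => rfl, fun hn => absurd h hn⟩
  · exact ⟨fun hn => absurd hn h, fun _ => rfl⟩

end GraphOfGroups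

namespace RatSub

/-! ### Decidability and programs -/

theorem generates_of_exists_word {M : Type*} [Monoid M] {n : ℕ} {gen : Fin n → M}
    (h : ∀ g, ∃ w, wordVal gen w = g) : Generates gen := by
  refine eq_top_iff.2 fun g _ => ?_
  obtain ⟨w, rfl⟩ := h g
  refine Submonoid.list_prod_mem _ fun x hx => ?_
  obtain ⟨i, -, rfl⟩ := List.mem_map.1 hx
  exact Submonoid.subset_closure ⟨i, rfl⟩

theorem exists_generates_of_fg (G : Type*) [Group G] (h : Group.FG G) :
    ∃ (n : ℕ) (gen : Fin n → G), Generates gen := by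
  obtain ⟨S, hS, hfin⟩ := Monoid.fg_iff.1 (Group.fg_iff_monoid_fg.1 h)
  obtain ⟨n, gen, -, hgen⟩ := hfin.fin_param
  exact ⟨n, gen, by rw [Generates, hgen, hS]⟩

/-- Decidability in the sense of `ComputablePred` means that some program decides the problem. -/
theorem computablePred_iff_decides {M : Type*} [Monoid M] {n : ℕ} (gen : Fin n → M) :
    ComputablePred (RationalMembership gen) ↔ ∃ c, Decides c gen := by
  classical
  constructor
  · rintro ⟨hd, hc⟩
    have hf : Computable fun I : Automaton n × List (Fin n) =>
        cond (decide (RationalMembership gen I)) 1 0 :=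
      Computable.cond hc (Computable.const 1) (Computable.const 0)
    obtain ⟨Φ, -, hΦ⟩ := GraphOfGroups.exists_program (α := Unit)
      (g := fun _ I => Part.some (cond (decide (RationalMembership gen I)) 1 0))
      (hf.partrec.comp Computable.snd)
    refine ⟨Φ (), fun I => ⟨fun h => ?_, fun h => ?_⟩⟩
    · exact (hΦ () I).trans (by simp [h])
    · exact (hΦ () I).trans (by simp [h])
  · rintro ⟨c, hc⟩
    have hp : Partrec fun I : Automaton n × List (Fin n) => c.eval (Encodable.encode I) :=
      Nat.Partrec.Code.eval_part.comp (Computable.const c) Computable.encode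
    have hf : Computable fun I : Automaton n × List (Fin n) =>
        if RationalMembership gen I then 1 else 0 := by
      refine Partrec.of_eq hp fun I => ?_
      by_cases h : RationalMembership gen I
      · rw [(hc I).1 h]; exact congrArg Part.some (if_pos h).symm
      · rw [(hc I).2 h]; exact congrArg Part.some (if_neg h).symm
    refine ⟨Classical.decPred _, ?_⟩
    refine ((Primrec.beq.to_comp.comp hf (Computable.const 1)).of_eq fun I => ?_)
    by_cases h : RationalMembership gen I <;> simp [h]

/-! ### Substitution of words for letters -/

/-- Replace each letter of a word by a word. -/
def substWord (ws : List (List ℕ)) (u : List ℕ) : List ℕ := u.flatMap fun i => (ws[i]?).getD []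

/-- Replace each letter by a word, in an instance of the rational subset problem. -/
def substInstance (ws : List (List ℕ)) (I : RawInstance) : RawInstance :=
  ((I.1.1, I.1.2.1, I.1.2.2.map fun e => (e.1, substWord ws e.2.1, e.2.2)), substWord ws I.2)

theorem primrec_substWord : Primrec₂ substWord :=
  Primrec.list_flatMap (f := fun a : List (List ℕ) × List ℕ => a.2)
    (g := fun a i => (a.1[i]?).getD []) Primrec.snd
    (Primrec.option_getD.comp₂ (Primrec.list_getElem?.comp₂ (Primrec.fst.comp Primrec.fst)
      Primrec.snd) (Primrec.const []))

theorem primrec_substInstance : Primrec₂ substInstance := by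
  have h : Primrec₂ fun (a : List (List ℕ) × RawInstance) (e : ℕ × List ℕ × ℕ) =>
      (e.1, substWord a.1 e.2.1, e.2.2) :=
    (Primrec.fst.comp Primrec.snd).pair ((primrec_substWord.comp (Primrec.fst.comp Primrec.fst)
      (Primrec.fst.comp (Primrec.snd.comp Primrec.snd))).pair
        (Primrec.snd.comp (Primrec.snd.comp Primrec.snd)))
  have hA : Primrec fun a : List (List ℕ) × RawInstance => a.2.1 := Primrec.fst.comp Primrec.snd
  exact ((Primrec.fst.comp hA).pair ((Primrec.fst.comp (Primrec.snd.comp hA)).pair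
    (Primrec.list_map (Primrec.snd.comp (Primrec.snd.comp hA)) h))).pair
      (primrec_substWord.comp Primrec.fst (Primrec.snd.comp Primrec.snd))

theorem Run.map_iff {M N : Type*} [Monoid M] [Monoid N] {n r : ℕ} {gen : Fin n → N}
    {gen' : Fin r → M} (φ : N →* M) (word : Fin n → List (Fin r))
    (hword : ∀ u, wordVal gen' (u.flatMap word) = φ (wordVal gen u))
    {E : List (ℕ × List (Fin n) × ℕ)} {p q : ℕ} {y : M} :
    Run gen' (E.map fun e => (e.1, e.2.1.flatMap word, e.2.2)) p q y ↔
      ∃ x, Run gen E p q x ∧ φ x = y := by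
  constructor
  · intro h
    induction h with
    | nil p => exact ⟨1, .nil p, map_one φ⟩
    | cons h _ ih =>
      obtain ⟨x, hx, rfl⟩ := ih
      obtain ⟨⟨p, u, q⟩, he, e⟩ := List.mem_map.1 h
      simp only [Prod.mk.injEq] at e
      obtain ⟨rfl, rfl, rfl⟩ := e
      exact ⟨_, .cons he hx, by rw [map_mul, hword]⟩
  · rintro ⟨x, h, rfl⟩
    induction h with
    | nil p => rw [map_one]; exact .nil p
    | cons h hx ih =>
      rw [map_mul, ← hword]
      exact .cons (List.mem_map.2 ⟨_, h, rfl⟩) ih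

/-- Rational subset problems can be pulled back along injective homomorphisms, uniformly. -/
theorem exists_pullback_program : ∃ Ψ : List (List ℕ) × Nat.Partrec.Code → Nat.Partrec.Code,
    Computable Ψ ∧ ∀ {M : Type u} {N : Type v} [Monoid M] [Monoid N] {n r : ℕ} (gen : Fin n → N)
      (gen' : Fin r → M) (φ : N →* M), Function.Injective φ → ∀ (word : Fin n → List (Fin r)),
      (∀ i, wordVal gen' (word i) = φ (gen i)) → ∀ c, Decides c gen' →
        Decides (Ψ (List.ofFn fun i => (word i).map Fin.val, c)) gen := by
  obtain ⟨Ψ, hΨ, h⟩ := GraphOfGroups.exists_program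
    (g := fun (a : List (List ℕ) × Nat.Partrec.Code) (I : RawInstance) =>
      a.2.eval (Encodable.encode (substInstance a.1 I)))
    (Nat.Partrec.Code.eval_part.comp (Computable.snd.comp Computable.fst)
      (Computable.encode.comp (primrec_substInstance.to_comp.comp
        (Computable.fst.comp Computable.fst) Computable.snd)))
  refine ⟨Ψ, hΨ, fun {M N _ _ n r} gen gen' φ hφ word hword c hc I => ?_⟩
  have hsubst : ∀ u : List (Fin n), substWord (List.ofFn fun i => (word i).map Fin.val)
      (u.map Fin.val) = (u.flatMap word).map Fin.val := by
    intro u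
    induction u with
    | nil => rfl
    | cons i u ih =>
      simp only [substWord, List.map_cons, List.flatMap_cons, List.map_append] at ih ⊢
      rw [ih]
      simp
  have hval : ∀ u, wordVal gen' (u.flatMap word) = φ (wordVal gen u) := by
    intro u
    induction u with
    | nil => simp [wordVal]
    | cons i u ih => rw [List.flatMap_cons, wordVal_append, ih, wordVal_cons, hword, map_mul]
  obtain ⟨⟨p, ts, E⟩, u⟩ := I
  have hI : substInstance (List.ofFn fun i => (word i).map Fin.val)
      (rawInstance ((p, ts, E), u)) = rawInstance
        ((p, ts, E.map fun e => (e.1, e.2.1.flatMap word, e.2.2)), u.flatMap word) := by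
    simp [substInstance, rawInstance, rawEdge, hsubst, Function.comp_def]
  have hiff : RationalMembership gen ((p, ts, E), u) ↔ RationalMembership gen'
      ((p, ts, E.map fun e => (e.1, e.2.1.flatMap word, e.2.2)), u.flatMap word) := by
    refine exists_congr fun t => and_congr_right fun _ => ?_
    simp only [hval]
    rw [Run.map_iff φ word hval]
    simp [hφ.eq_iff]
  rw [← encode_rawInstance, h, hI, encode_rawInstance, hiff]
  exact hc _

end RatSub

namespace GraphOfGroups

open RatSub

variable {V : Type u} {ε : Type v} {𝒢 : GraphOfGroups.{u, v, w, x} V ε} {v₀ : V}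

/-! ### Vertex groups in the fundamental group -/

/-- The embedding of a vertex group into the fundamental group which conjugates by the value of a
path. -/
noncomputable def conjEmb {a : V} {l : Words V ε 𝒢.G} (hl : 𝒢.IsPathWord v₀ a l) :
    𝒢.G a →* 𝒢.fundamentalGroup v₀ :=
  ((MulAut.conj (𝒢.evalG l)).toMonoidHom.comp (𝒢.ofVertex a)).codRestrict _ fun g => by
    obtain ⟨l', h', e⟩ := 𝒢.exists_inv_word hl
    refine ⟨l ++ Sum.inl ⟨a, g⟩ :: l', hl.append 𝒢 ⟨rfl, h'⟩, ?_⟩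
    rw [evalG_append, evalG_inl_cons, e, ← mul_assoc]
    rfl

theorem conjEmb_injective {a : V} {l : Words V ε 𝒢.G} (hl : 𝒢.IsPathWord v₀ a l) :
    Function.Injective (conjEmb hl) := by
  intro g h e
  exact 𝒢.ofVertex_injective a ((MulAut.conj (𝒢.evalG l)).injective (congrArg Subtype.val e))

/-! ### Generators of the fundamental group -/

/-- In a connected graph there are paths without vertex letters, together with inverse paths. -/
theorem exists_path (X : V → Type*) (gen : ∀ a, X a → 𝒢.G a) {a b : V}
    (h : Relation.ReflTransGen (fun c d => ∃ y, 𝒢.src y = c ∧ 𝒢.tgt y = d) a b) :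
    ∃ l l' : Words V ε X, 𝒢.IsPathWord a b l ∧ 𝒢.IsPathWord b a l' ∧
      𝒢.eval gen l' = (𝒢.eval gen l)⁻¹ := by
  induction h with
  | refl => exact ⟨[], [], rfl, rfl, by simp [eval]⟩
  | tail _ hy ih =>
    obtain ⟨l, l', h, h', e⟩ := ih
    obtain ⟨y, rfl, rfl⟩ := hy
    refine ⟨l ++ [Sum.inr y], Sum.inr (bar y) :: l', h.append 𝒢 ⟨rfl, rfl⟩, ⟨rfl, ?_⟩, ?_⟩
    · rwa [tgt, bar_bar]
    · rw [eval_inr_cons, eval_append, e, mul_inv_rev, eval_inr_cons, eval_nil, mul_one,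
        eq_inv_of_mul_eq_one_right (𝒢.ofEdge_mul_bar y)]

theorem eval_mem_fundamentalGroup {X : V → Type*} (gen : ∀ a, X a → 𝒢.G a) {l : Words V ε X}
    (hl : 𝒢.IsPathWord v₀ v₀ l) : 𝒢.eval gen l ∈ 𝒢.fundamentalGroup v₀ := by
  refine ⟨l.map (Sum.map (fun s => ⟨s.1, gen s.1 s.2⟩) id), ?_, ?_⟩
  · suffices h : ∀ a, 𝒢.IsPathWord a v₀ l →
        𝒢.IsPathWord a v₀ (l.map (Sum.map (fun s => ⟨s.1, gen s.1 s.2⟩) id) : Words V ε 𝒢.G) from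
      h _ hl
    clear hl
    induction l with
    | nil => exact fun _ h => h
    | cons s l ih => cases s <;> exact fun _ h => ⟨h.1, ih _ h.2⟩
  · clear hl
    induction l with
    | nil => rfl
    | cons s l ih =>
      cases s with
      | inl s => rw [eval_inl_cons, ← ih]; exact evalG_inl_cons _ _
      | inr y => rw [eval_inr_cons, ← ih]; exact evalG_inr_cons _ _

/-- The fundamental group of a finite connected graph of finitely generated groups is generated
by words of cycle type: the generators of the vertex groups and the edges, each closed up by
paths from and to the base vertex. -/
theorem exists_piGen [Finite V] [Finite ε] (h𝒢 : 𝒢.Connected) (v₀ : V) (n : V → ℕ)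
    (gen : ∀ a, Fin (n a) → 𝒢.G a) (hgen : ∀ a, Generates (gen a)) :
    ∃ (r : ℕ) (piGen : Fin r → 𝒢.fundamentalGroup v₀)
      (piWord : Fin r → Words V ε (fun a => Fin (n a))), Generates piGen ∧
      (∀ j, 𝒢.IsPathWord v₀ v₀ (piWord j)) ∧ ∀ j, 𝒢.eval gen (piWord j) = piGen j := by
  classical
  have hpath : ∀ a, ∃ l l' : Words V ε (fun a => Fin (n a)), 𝒢.IsPathWord v₀ a l ∧
      𝒢.IsPathWord a v₀ l' ∧ 𝒢.eval gen l' = (𝒢.eval gen l)⁻¹ ∧ (a = v₀ → 𝒢.eval gen l = 1) := by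
    intro a
    by_cases ha : a = v₀
    · subst ha
      exact ⟨[], [], rfl, rfl, by simp [eval], fun _ => eval_nil _⟩
    · obtain ⟨l, l', h1, h2, h3⟩ := exists_path (fun a => Fin (n a)) gen (h𝒢 v₀ a)
      exact ⟨l, l', h1, h2, h3, fun h => absurd h ha⟩
  choose P P' hP hP' hPP' hP1 using hpath
  obtain ⟨r, ⟨e⟩⟩ := Finite.exists_equiv_fin ((Σ a, Fin (n a)) ⊕ (ε × Bool))
  set word : (Σ a, Fin (n a)) ⊕ (ε × Bool) → Words V ε (fun a => Fin (n a)) :=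
    Sum.elim (fun s => P s.1 ++ Sum.inl s :: P' s.1)
      (fun y => P (𝒢.src y) ++ Sum.inr y :: P' (𝒢.tgt y)) with hword
  have hcycle : ∀ z, 𝒢.IsPathWord v₀ v₀ (word z) := by
    rintro (s | y)
    · exact (hP _).append 𝒢 ⟨rfl, hP' _⟩
    · exact (hP _).append 𝒢 ⟨rfl, hP' _⟩
  set piGen : Fin r → 𝒢.fundamentalGroup v₀ := fun j =>
    ⟨𝒢.eval gen (word (e.symm j)), eval_mem_fundamentalGroup gen (hcycle _)⟩ with hpi
  refine ⟨r, piGen, fun j => word (e.symm j), ?_, fun j => hcycle _, fun j => rfl⟩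
  have hpi' : ∀ z, ((piGen (e z) : 𝒢.fundamentalGroup v₀) : 𝒢.F) = 𝒢.eval gen (word z) := by
    intro z
    simp [hpi]
  have hval : ∀ u u' : List (Fin r),
      ((wordVal piGen (u ++ u') : 𝒢.fundamentalGroup v₀) : 𝒢.F) =
        (wordVal piGen u : 𝒢.fundamentalGroup v₀) * (wordVal piGen u' : 𝒢.fundamentalGroup v₀) :=
    fun u u' => by rw [wordVal_append]; rfl
  -- Vertex elements, closed up by the chosen paths, are products of generators; so are whole words
  -- along edge paths, since the chosen paths cancel between consecutive letters.
  have hvertex : ∀ (a : V) (g : 𝒢.G a), ∃ u,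
      ((wordVal piGen u : 𝒢.fundamentalGroup v₀) : 𝒢.F) =
        𝒢.eval gen (P a) * 𝒢.ofVertex a g * (𝒢.eval gen (P a))⁻¹ := by
    intro a g
    obtain ⟨w, rfl⟩ := (hgen a).exists_word g
    induction w with
    | nil => exact ⟨[], by simp [wordVal]⟩
    | cons i w ih =>
      obtain ⟨u, hu⟩ := ih
      refine ⟨e (Sum.inl ⟨a, i⟩) :: u, ?_⟩
      rw [wordVal_cons, Subgroup.coe_mul, hu, hpi', wordVal_cons, map_mul]
      simp only [hword, Sum.elim_inl, eval_append, eval_inl_cons, hPP']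
      group
  have hall : ∀ (l : Words V ε 𝒢.G) (a b : V), 𝒢.IsPathWord a b l → ∃ u,
      ((wordVal piGen u : 𝒢.fundamentalGroup v₀) : 𝒢.F) =
        𝒢.eval gen (P a) * 𝒢.evalG l * (𝒢.eval gen (P b))⁻¹ := by
    intro l
    induction l with
    | nil =>
      rintro a b rfl
      exact ⟨[], by rw [evalG_nil]; simp [wordVal]⟩
    | cons s l ih =>
      intro a b h
      cases s with
      | inl s =>
        obtain ⟨c, g⟩ := s
        obtain ⟨rfl, h⟩ := h
        obtain ⟨u, hu⟩ := ih _ _ h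
        obtain ⟨u', hu'⟩ := hvertex c g
        refine ⟨u' ++ u, ?_⟩
        rw [hval, hu, hu', evalG_inl_cons]
        group
      | inr y =>
        obtain ⟨rfl, h⟩ := h
        obtain ⟨u, hu⟩ := ih _ _ h
        refine ⟨e (Sum.inr y) :: u, ?_⟩
        rw [wordVal_cons, Subgroup.coe_mul, hu, hpi', evalG_inr_cons]
        simp only [hword, Sum.elim_inr, eval_append, eval_inr_cons, hPP']
        group
  refine generates_of_exists_word ?_
  rintro ⟨_, l, hl, rfl⟩
  obtain ⟨u, hu⟩ := hall l _ _ hl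
  refine ⟨u, Subtype.ext ?_⟩
  rw [hu, hP1 v₀ rfl]
  simp

/-! ### Descriptions -/

/-- The raw description given by numberings of the vertices and edges, generators, and words. -/
def rawOfEquiv {k m : ℕ} (𝒢 : GraphOfGroups.{u, v, w, x} V ε) (v₀ : V) (eV : V ≃ Fin k)
    (eE : ε ≃ Fin m) (n : V → ℕ)
    (edgeWords : ∀ e : ε,
      List (List (Fin (n (𝒢.src (e, true)))) × List (Fin (n (𝒢.src (e, false))))))
    {r : ℕ} (piWord : Fin r → Words V ε (fun a => Fin (n a))) : RawDescription :=
  (List.ofFn fun i => n (eV.symm i),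
   List.ofFn fun j => (((eV (𝒢.src (eE.symm j, true)) : ℕ), (eV (𝒢.src (eE.symm j, false)) : ℕ)),
     (edgeWords (eE.symm j)).map fun q => (q.1.map Fin.val, q.2.map Fin.val)),
   (eV v₀ : ℕ),
   List.ofFn fun j => (piWord j).map
     (Sum.map (fun s => ((eV s.1 : ℕ), (s.2 : ℕ))) (fun y => ((eE y.1 : ℕ), y.2))))

/-- The coding that belongs to `rawOfEquiv`. -/
def Coding.ofEquiv {k m : ℕ} (eV : V ≃ Fin k) (eE : ε ≃ Fin m) (n : V → ℕ)
    (gen : ∀ a, Fin (n a) → 𝒢.G a) (hgen : ∀ a, Generates (gen a))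
    (edgeWords : ∀ e : ε,
      List (List (Fin (n (𝒢.src (e, true)))) × List (Fin (n (𝒢.src (e, false))))))
    (hedge : ∀ e,
      {p | ∃ q ∈ edgeWords e, p = (wordVal (gen _) q.1, wordVal (gen _) q.2)} =
        Set.range fun g : 𝒢.K e => (𝒢.α (e, true) g, 𝒢.α (e, false) g))
    {r : ℕ} (piGen : Fin r → 𝒢.fundamentalGroup v₀)
    (piWord : Fin r → Words V ε (fun a => Fin (n a)))
    (hcycle : ∀ j, 𝒢.IsPathWord v₀ v₀ (piWord j))
    (heval : ∀ j, 𝒢.eval gen (piWord j) = piGen j) :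
    Coding 𝒢 v₀ (rawOfEquiv 𝒢 v₀ eV eE n edgeWords piWord) where
  nv a := eV a
  nv_injective := Fin.val_injective.comp eV.injective
  ne e := eE e
  ne_injective := Fin.val_injective.comp eE.injective
  n := n
  gen := gen
  gen_generates := hgen
  edgeWords := edgeWords
  edgeWords_spec := hedge
  r := r
  piGen := piGen
  piWord := piWord
  piWord_cycle := hcycle
  piWord_eval := heval
  n_eq a := by simp [rawOfEquiv]
  edge_eq e := by
    simp only [rawOfEquiv, List.getElem?_ofFn, Fin.is_lt, dif_pos, Fin.eta]
    rw [eE.symm_apply_apply]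
  base_eq := rfl
  word_eq j := by simp [rawOfEquiv]

/-- The coding that belongs to a description. -/
def Description.toCoding {k m : ℕ} {𝒢 : GraphOfGroups.{0, 0, w, x} (Fin k) (Fin m)} {v₀ : Fin k}
    (D : 𝒢.Description v₀) : Coding 𝒢 v₀ D.code :=
  Coding.ofEquiv (Equiv.refl _) (Equiv.refl _) D.n D.gen D.gen_generates D.edgeWords
    D.edgeWords_spec D.piGen D.piWord D.piWord_cycle D.piWord_eval

theorem exists_edgeWords {n : V → ℕ} {gen : ∀ a, Fin (n a) → 𝒢.G a}
    (hgen : ∀ a, Generates (gen a)) (e : ε) [Finite (𝒢.K e)] :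
    ∃ L : List (List (Fin (n (𝒢.src (e, true)))) × List (Fin (n (𝒢.src (e, false))))),
      {p | ∃ q ∈ L, p = (wordVal (gen _) q.1, wordVal (gen _) q.2)} =
        Set.range fun g : 𝒢.K e => (𝒢.α (e, true) g, 𝒢.α (e, false) g) := by
  have := Fintype.ofFinite (𝒢.K e)
  choose f hf using fun k : 𝒢.K e => (hgen _).exists_word (𝒢.α (e, true) k)
  choose f' hf' using fun k : 𝒢.K e => (hgen _).exists_word (𝒢.α (e, false) k)
  refine ⟨Finset.univ.toList.map fun k => (f k, f' k), ?_⟩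
  ext p
  simp only [List.mem_map, Finset.mem_toList, Finset.mem_univ, true_and, Set.mem_ofPred_eq,
    exists_exists_eq_and, hf, hf', Set.mem_range]
  simp only [eq_comm]

theorem decidable_fundamentalGroup [Finite V] [Finite ε] (h𝒢 : 𝒢.Connected)
    (hK : ∀ e, Finite (𝒢.K e)) (v₀ : V) (h : ∀ a, DecidableRationalSubsetProblem (𝒢.G a)) :
    DecidableRationalSubsetProblem (𝒢.fundamentalGroup v₀) := by
  choose n gen hgen hdec using h
  simp only [computablePred_iff_decides] at hdec
  choose c hc using hdec
  obtain ⟨r, piGen, piWord, hpi, hcycle, heval⟩ := exists_piGen h𝒢 v₀ n gen hgen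
  choose edgeWords hedge using fun e => exists_edgeWords hgen e
  obtain ⟨k, ⟨eV⟩⟩ := Finite.exists_equiv_fin V
  obtain ⟨m, ⟨eE⟩⟩ := Finite.exists_equiv_fin ε
  obtain ⟨Φ, -, hΦ⟩ := exists_uniform_program.{u, v, w, x}
  refine ⟨r, piGen, hpi, (computablePred_iff_decides _).2 ⟨_, hΦ
    (Coding.ofEquiv eV eE n gen hgen edgeWords hedge piGen piWord hcycle heval)
    (List.ofFn fun i => c (eV.symm i)) fun a => ⟨c a, ?_, hc a⟩⟩⟩
  simp [Coding.ofEquiv]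

theorem decidable_vertexGroup (h𝒢 : 𝒢.Connected) (v₀ a : V) (hG : Group.FG (𝒢.G a))
    (h : DecidableRationalSubsetProblem (𝒢.fundamentalGroup v₀)) :
    DecidableRationalSubsetProblem (𝒢.G a) := by
  obtain ⟨r, piGen, hpi, hdec⟩ := h
  obtain ⟨c, hc⟩ := (computablePred_iff_decides _).1 hdec
  obtain ⟨n, gen, hgen⟩ := exists_generates_of_fg _ hG
  obtain ⟨l, -, hl, -⟩ := exists_path 𝒢.G (fun _ g => g) (h𝒢 v₀ a)
  choose word hword using fun i => hpi.exists_word (conjEmb hl (gen i))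
  obtain ⟨Ψ, -, hΨ⟩ := exists_pullback_program
  exact ⟨n, gen, hgen, (computablePred_iff_decides _).2
    ⟨_, hΨ gen piGen (conjEmb hl) (conjEmb_injective hl) word hword c hc⟩⟩

end GraphOfGroups

theorem mainTheorem1 :
    -- decidability of the rational subset problem
    (∀ (V : Type u) (ε : Type v) [Finite V] [Finite ε] (𝒢 : GraphOfGroups.{u, v, w, x} V ε)
        (_ : 𝒢.Connected) (_ : ∀ a, Group.FG (𝒢.G a)) (_ : ∀ e, Finite (𝒢.K e)) (v₀ : V),
        RatSub.DecidableRationalSubsetProblem (𝒢.fundamentalGroup v₀) ↔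
          ∀ a, RatSub.DecidableRationalSubsetProblem (𝒢.G a)) ∧
    -- from algorithms for the vertex groups, compute an algorithm for the fundamental group
    (∃ Φ : GraphOfGroups.RawDescription × List Nat.Partrec.Code → Nat.Partrec.Code,
      Computable Φ ∧
      ∀ (k m : ℕ) (𝒢 : GraphOfGroups.{0, 0, w, x} (Fin k) (Fin m)) (_ : 𝒢.Connected)
        (_ : ∀ e, Finite (𝒢.K e)) (v₀ : Fin k) (D : 𝒢.Description v₀)
        (c : Fin k → Nat.Partrec.Code), (∀ a, RatSub.Decides (c a) (D.gen a)) →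
          RatSub.Decides (Φ (D.code, List.ofFn c)) D.piGen) ∧
    -- from an algorithm for the fundamental group, compute algorithms for the vertex groups
    (∃ Ψ : GraphOfGroups.RawDescription × List (List (List ℕ)) × Nat.Partrec.Code × ℕ →
        Nat.Partrec.Code,
      Computable Ψ ∧
      ∀ (k m : ℕ) (𝒢 : GraphOfGroups.{0, 0, w, x} (Fin k) (Fin m)) (_ : 𝒢.Connected)
        (_ : ∀ e, Finite (𝒢.K e)) (v₀ : Fin k) (D : 𝒢.Description v₀) (T : D.VertexWords)
        (c : Nat.Partrec.Code), RatSub.Decides c D.piGen →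
          ∀ a : Fin k, RatSub.Decides (Ψ (D.code, T.code, c, (a : ℕ))) (D.gen a)) := by
  refine ⟨fun V ε _ _ 𝒢 h𝒢 hG hK v₀ => ⟨fun h a =>
    GraphOfGroups.decidable_vertexGroup h𝒢 v₀ a (hG a) h,
    GraphOfGroups.decidable_fundamentalGroup h𝒢 hK v₀⟩, ?_, ?_⟩
  · obtain ⟨Φ, hΦ, h⟩ := GraphOfGroups.exists_uniform_program.{0, 0, w, x}
    refine ⟨Φ, hΦ, fun k m 𝒢 _ _ v₀ D c hc => h D.toCoding _ fun a => ⟨c a, ?_, hc a⟩⟩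
    simp [GraphOfGroups.Description.toCoding, GraphOfGroups.Coding.ofEquiv]
  · obtain ⟨Ψ, hΨ, h⟩ := RatSub.exists_pullback_program
    have hget : Primrec fun z : GraphOfGroups.RawDescription × List (List (List ℕ)) ×
        Nat.Partrec.Code × ℕ => ((z.2.1[z.2.2.2]?).getD [], z.2.2.1) :=
      (Primrec.option_getD.comp (Primrec.list_getElem?.comp (Primrec.fst.comp Primrec.snd)
        (Primrec.snd.comp (Primrec.snd.comp Primrec.snd))) (Primrec.const [])).pair
          (Primrec.fst.comp (Primrec.snd.comp Primrec.snd))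
    refine ⟨fun z => Ψ ((z.2.1[z.2.2.2]?).getD [], z.2.2.1), hΨ.comp hget.to_comp,
      fun k m 𝒢 _ _ v₀ D T c hc a => ?_⟩
    obtain ⟨l, hl, hspec⟩ := T.spec a
    have := h (D.gen a) D.piGen (GraphOfGroups.conjEmb hl) (GraphOfGroups.conjEmb_injective hl)
      (T.word a) (fun i => Subtype.ext (hspec i)) c hc
    simpa [GraphOfGroups.Description.VertexWords.code] using this
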